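/- **Setting.** Let $E=(E^0,E^1,s,r)$ be a finite directed graph without sinks (every vertex emits an edge). A path of length $k$ is a word $\alpha=e_1\cdots e_k$ of edges with $s(e_j)=r(e_{j+1})$; put $s(\alpha)=s(e_k)$, $r(\alpha)=r(e_1)$; paths of length $0$ are the vertices. Let $A=c(E^0)$, and let $X_E^{\otimes k}$ be the $A$-correspondence of functions on the paths of length $k$, with $(a\xi)(\alpha)=a(r(\alpha))\xi(\alpha)$, $(\xi a)(\alpha)=\xi(\alpha)a(s(\alpha))$ and $\langle\xi,\eta\rangle(v)=\sum_{s(\alpha)=v}\overline{\xi(\alpha)}\eta(\alpha)$. Let $\mathcal F=\bigoplus_{k\ge0}X_E^{\otimes k}$ be the Fock correspondence, $\mathcal L(\mathcal F)$ its adjointable operators, $\mathcal K$ the closed span of the operators $\theta_{\xi,\eta}\zeta=\xi\langle\eta,\zeta\rangle$, and $q:\mathcal L(\mathcal F)\to\mathcal L(\mathcal F)/\mathcal K$ the quotient map. For $e\in E^1$ let $S_e\delta_\beta=\delta_{e\beta}$ (and $S_e\delta_\beta=0$ if $s(e)\ne r(\beta)$); for a path $\alpha=e_1\cdots e_n$,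 $n\geq 1$, let $u_\alpha=q(S_{e_1}\cdots S_{e_n})$. A weight sequence is a sequence $Z_k\in\mathcal L(X_E^{\otimes k})$ of positive invertible operators commuting with the left action of $A$, with $Z_0=I$, $\sup_k\|Z_k\|<\infty$, and $Z_k\ge\epsilon I$ for all $k\ge1$ and some $\epsilon>0$. Fix one, let $Z=\mathrm{diag}(Z_0,Z_1,\dots)$ and let $\mathcal T$ be the $C^*$-algebra generated by $\{ZS_e:e\in E^1\}$. Let $Q_k$ be the projection of $\mathcal F$ onto $X_E^{\otimes k}$, $W_t=\sum_k e^{ikt}Q_k$, $\gamma_t(X)=W_tXW_t^*$, $\mathcal D=\{X\in\mathcal T:\gamma_t(X)=X\ \forall t\in\mathbb R\}$, $F=\{X\in\mathcal T:\gamma_t(X)=e^{it}X\ \forall t\in\mathbb R\}$, and let $F^n$ be the linear span of the products of $n$ elements of $F$. Both $q(\mathcal D)$ and $q(F^n)$ are $C^*$-correspondences over $q(\mathcal D)$, with actions by multiplication and inner product $\langle x,y\rangle=x^*y$; an isomorphism of correspondences is a surjective linear bimodule map that preserves the inner product. $E$ is called irreducible if for any two vertices there is a path from one of them to the other (in at least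 one of the two directions). For $1\le l\le k$, $E=C_{k,l}$ means that $E^0=\{v_1,\dots,v_k\}$ and $E^1=\{e_1,\dots,e_k\}$ (distinct elements), with $e_i$ going from $v_i$ to $v_{i+1}$ for $i<k$ and $e_k$ from $v_k$ to $v_l$; such a graph is called a cycle with an entry. **Proposition.** Let $n\ge1$. (1) Suppose that $E$ is non-empty, irreducible, has no sources (every vertex receives an edge) and is not a cycle with an entry. Then there is no isomorphism of correspondences $w:q(\mathcal D)\to q(F^n)$. More generally, with sources allowed and without irreducibility, there is no such isomorphism if some vertex emits at least two edges and is the range of paths of every length. (2) Suppose that $E=C_{k,l}$. Then every $u_\alpha$ with $|\alpha|=n$ commutes with $q(\mathcal D)$ if and only if there is an isomorphism of correspondences $w:q(\mathcal D)\to q(F^n)$. -/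

import Mathlib

open scoped ComplexConjugate

noncomputable section

namespace WCK

/-- A directed graph with vertex set `V`, edge set `E`, source map `s` and range map `r`. -/
structure DGraph (V E : Type*) where
  s : E → V
  r : E → V

namespace DGraph

variable {V E : Type*} (G : DGraph V E)

/-- A vertex is a sink if it emits no edge. -/
def IsSink (v : V) : Prop := ∀ e, G.s e ≠ v

/-- A vertex is a source if it receives no edge. -/
def IsSource (v : V) : Prop := ∀ e, G.r e ≠ v

/-- A path `e₁ e₂ ⋯ eₙ` of length `n`, with `s eᵢ = r eᵢ₊₁`, recorded with the vertices
`r e₁, s e₁, …, s eₙ` that it visits; paths of length `0` are the vertices. -/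
@[ext]
structure Path (n : ℕ) where
  edge : Fin n → E
  vert : Fin (n + 1) → V
  r_edge : ∀ i, G.r (edge i) = vert i.castSucc
  s_edge : ∀ i, G.s (edge i) = vert i.succ

variable {G}

/-- The source `s(α) = s(eₙ)` of a path. -/
def Path.src {n : ℕ} (α : G.Path n) : V := α.vert (Fin.last n)

/-- The range `r(α) = r(e₁)` of a path. -/
def Path.rng {n : ℕ} (α : G.Path n) : V := α.vert 0

/-- The path `e₂ ⋯ eₙ₊₁` obtained from `e₁ e₂ ⋯ eₙ₊₁`. -/
def Path.tail {n : ℕ} (α : G.Path (n + 1)) : G.Path n where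
  edge i := α.edge i.succ
  vert i := α.vert i.succ
  r_edge i := α.r_edge i.succ
  s_edge i := α.s_edge i.succ

theorem Path.tail_injOn {n : ℕ} {α β : G.Path (n + 1)} (h0 : α.edge 0 = β.edge 0)
    (h : α.tail = β.tail) : α = β := by
  have he : ∀ i : Fin n, α.edge i.succ = β.edge i.succ := fun i =>
    congrFun (congrArg Path.edge h) i
  have hv : ∀ i : Fin (n + 1), α.vert i.succ = β.vert i.succ := fun i =>
    congrFun (congrArg Path.vert h) i
  ext i
  · exact Fin.cases h0 he i
  · refine Fin.cases ?_ hv i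
    have h1 := α.r_edge 0
    have h2 := β.r_edge 0
    rw [h0] at h1
    exact h1.symm.trans h2

instance [Finite V] [Finite E] (n : ℕ) : Finite (G.Path n) :=
  Finite.of_injective (fun α : G.Path n => (α.edge, α.vert)) fun α β h => by
    ext i
    · exact congrFun (congrArg Prod.fst h) i
    · exact congrFun (congrArg Prod.snd h) i

instance [Finite V] [Finite E] (n : ℕ) : Fintype (G.Path n) := Fintype.ofFinite _

variable (G)

/-- `G` is irreducible: of any two vertices, one can be reached from the other. -/
def Irreducible : Prop :=
  ∀ v w : V, (∃ (n : ℕ) (α : G.Path n), α.src = v ∧ α.rng = w) ∨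
    (∃ (n : ℕ) (α : G.Path n), α.src = w ∧ α.rng = v)

/-- `G` is the cycle with an entry `C_{k,l}`, `1 ≤ l ≤ k`: the vertices are `v₁, …, v_k`, the edges
are `e₁, …, e_k`, with `eᵢ : vᵢ → vᵢ₊₁` for `i < k` and `e_k : v_k → v_l`.
(The index `i : Fin k` stands for `i + 1`.) -/
def IsC (k l : ℕ) : Prop :=
  1 ≤ l ∧ l ≤ k ∧ ∃ (v : Fin k ≃ V) (e : Fin k ≃ E),
    (∀ i, G.s (e i) = v i) ∧
    (∀ i j : Fin k, (i : ℕ) + 1 = j → G.r (e i) = v j) ∧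
    (∀ i j : Fin k, (i : ℕ) + 1 = k → (j : ℕ) + 1 = l → G.r (e i) = v j)

/-- `G` is a cycle with an entry. -/
def IsCycleWithEntry : Prop := ∃ k l : ℕ, G.IsC k l

end DGraph

variable {V E : Type*} [Fintype V] [Fintype E]

/-! ### The correspondences `X_E^{⊗ k}` and the Fock correspondence -/

/-- The correspondence `X_E^{⊗ k} = X_{E^k}` over `A = c(E⁰)`: the functions on the paths of
length `k`. Its `A`-valued inner product is `levelInner`. As `E⁰` is finite, the norm of the
Hilbert `A`-module is equivalent to the `ℓ²` norm used here, and the two operator norms of an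
adjointable operator are equal. -/
abbrev Level (G : DGraph V E) (k : ℕ) : Type _ := EuclideanSpace ℂ (G.Path k)

/-- The Fock correspondence `⨁ₖ X_E^{⊗ k}`. A sequence `ξ` belongs to the direct sum of Hilbert
`A`-modules iff `∑ₖ ⟨ξₖ, ξₖ⟩` converges in `A = c(E⁰)`; as `E⁰` is finite this means
`∑ₖ ‖ξₖ‖² < ∞`. -/
abbrev Fock (G : DGraph V E) : Type _ := lp (fun k : ℕ => Level G k) 2

variable (G : DGraph V E)

/-- The `A`-valued inner product `⟨ξ, η⟩(v) = ∑_{s(β) = v} conj (ξ β) * η β` of `X_E^{⊗ k}`. -/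
def levelInner {k : ℕ} (ξ η : Level G k) : V → ℂ :=
  open Classical in
  fun v => ∑ β : G.Path k, if β.src = v then conj (ξ β) * η β else 0

/-- The `A`-valued inner product of the Fock correspondence. -/
def fockInner (ξ η : Fock G) : V → ℂ := fun v => ∑' k, levelInner G (ξ k) (η k) v

/-- `T` is adjointable with respect to the `A`-valued inner product `ip`. -/
def IsAdjointable {H : Type*} (ip : H → H → V → ℂ) (T : H → H) : Prop :=
  ∃ S : H → H, ∀ ξ η, ip (T ξ) η = ip ξ (S η)

/-- Pointwise multiplication by a function on the paths of length `k`. -/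
def mulBy {k : ℕ} (f : G.Path k → ℂ) : Level G k →L[ℂ] Level G k :=
  LinearMap.toContinuousLinearMap
    { toFun := fun ξ => WithLp.toLp 2 fun β => f β * ξ β
      map_add' := fun ξ η => by ext β; simp [mul_add]
      map_smul' := fun c ξ => by ext β; simp [mul_left_comm] }

@[simp]
theorem mulBy_apply {k : ℕ} (f : G.Path k → ℂ) (ξ : Level G k) (β : G.Path k) :
    mulBy G f ξ β = f β * ξ β := rfl

/-- The left action `(a · ξ)(β) = a(r(β)) ξ(β)` of `A` on `X_E^{⊗ k}`. -/
def levelLeft (k : ℕ) (a : V → ℂ) : Level G k →L[ℂ] Level G k := mulBy G fun β => a β.rng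

/-- The right action `(ξ · a)(β) = ξ(β) a(s(β))` of `A` on `X_E^{⊗ k}`. -/
def levelRight (k : ℕ) (a : V → ℂ) : Level G k →L[ℂ] Level G k := mulBy G fun β => a β.src

theorem norm_mulBy_le {k : ℕ} (f : G.Path k → ℂ) (C : ℝ) (hC : 0 ≤ C) (hf : ∀ β, ‖f β‖ ≤ C) :
    ‖mulBy G f‖ ≤ C := by
  refine ContinuousLinearMap.opNorm_le_bound _ hC fun ξ => ?_
  rw [EuclideanSpace.norm_eq, EuclideanSpace.norm_eq,
    show C = √(C ^ 2) from (Real.sqrt_sq hC).symm, ← Real.sqrt_mul (sq_nonneg C)]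
  refine Real.sqrt_le_sqrt ?_
  rw [Finset.mul_sum]
  refine Finset.sum_le_sum fun β _ => ?_
  rw [mulBy_apply, norm_mul, mul_pow]
  gcongr
  exact hf β

section diag

variable {G}

theorem diag_memℓp (T : ∀ k, Level G k →L[ℂ] Level G k) (h : ∃ C, ∀ k, ‖T k‖ ≤ C) (ξ : Fock G) :
    Memℓp (fun k => T k (ξ k)) 2 := by
  obtain ⟨C, hC⟩ := h
  refine ((lp.memℓp ξ).const_smul (C : ℂ)).mono' fun k => ?_
  have h0 : 0 ≤ C := (norm_nonneg _).trans (hC k)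
  rw [Pi.smul_apply, norm_smul, Complex.norm_real, Real.norm_of_nonneg h0]
  exact (T k).le_of_opNorm_le (hC k) _

/-- The diagonal operator `diag(T₀, T₁, …)` on the Fock correspondence, for a bounded sequence of
operators. -/
def diag (T : ∀ k, Level G k →L[ℂ] Level G k) (h : ∃ C, ∀ k, ‖T k‖ ≤ C) :
    Fock G →L[ℂ] Fock G :=
  LinearMap.mkContinuousOfExistsBound
    { toFun := fun ξ => ⟨fun k => T k (ξ k), diag_memℓp T h ξ⟩
      map_add' := fun ξ η => by ext1; funext k; exact map_add (T k) (ξ k) (η k)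
      map_smul' := fun c ξ => by ext1; funext k; exact map_smul (T k) c (ξ k) }
    (by
      obtain ⟨C, hC⟩ := h
      have h0 : 0 ≤ C := (norm_nonneg _).trans (hC 0)
      refine ⟨C, fun ξ => ?_⟩
      have key : ‖(C : ℂ) • ξ‖ = C * ‖ξ‖ := by
        rw [norm_smul, Complex.norm_real, Real.norm_of_nonneg h0]
      rw [← key]
      refine lp.norm_mono (by norm_num) fun k => ?_
      rw [lp.coeFn_smul, Pi.smul_apply, norm_smul, Complex.norm_real, Real.norm_of_nonneg h0]
      exact (T k).le_of_opNorm_le (hC k) _)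

@[simp]
theorem diag_apply (T : ∀ k, Level G k →L[ℂ] Level G k) (h : ∃ C, ∀ k, ‖T k‖ ≤ C) (ξ : Fock G)
    (k : ℕ) : diag T h ξ k = T k (ξ k) := rfl

end diag

/-- The right action of `A = c(E⁰)` on the Fock correspondence. -/
def fockRight (a : V → ℂ) : Fock G →L[ℂ] Fock G :=
  diag (fun k => levelRight G k a)
    ⟨‖a‖, fun _ => norm_mulBy_le G _ _ (norm_nonneg _) fun β => norm_le_pi_norm a β.src⟩

@[simp]
theorem fockRight_apply (a : V → ℂ) (ξ : Fock G) (k : ℕ) (β : G.Path k) :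
    fockRight G a ξ k β = a β.src * ξ k β := rfl

/-! ### Adjointable operators are the bounded maps commuting with the right action -/

theorem isAdjointable_iff {H : Type*} [NormedAddCommGroup H] [InnerProductSpace ℂ H]
    [CompleteSpace H] (ip : H → H → V → ℂ) (R : V → H →L[ℂ] H)
    (hip : ∀ ξ η v, ip ξ η v = inner ℂ (R v ξ) η) (hR : ∀ ξ, ∑ v, R v ξ = ξ) (T : H →L[ℂ] H) :
    IsAdjointable ip T ↔ ∀ v ξ, T (R v ξ) = R v (T ξ) := by
  constructor
  · rintro ⟨S, hS⟩ v ξ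
    have h1 : ∀ v ξ η, inner ℂ (R v (T ξ)) η = inner ℂ (R v ξ) (S η) := fun v ξ η => by
      rw [← hip, ← hip, hS]
    have h2 : ∀ ξ η, inner ℂ (T ξ) η = inner ℂ ξ (S η) := fun ξ η => by
      rw [← hR (T ξ), sum_inner]
      simp_rw [h1]
      rw [← sum_inner, hR]
    refine ext_inner_right ℂ fun η => ?_
    rw [h1, h2]
  · intro h
    refine ⟨T.adjoint, fun ξ η => funext fun v => ?_⟩
    rw [hip, hip, ← h, ContinuousLinearMap.adjoint_inner_right]

open Classical in
theorem levelInner_eq {k : ℕ} (ξ η : Level G k) (v : V) :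
    levelInner G ξ η v = inner ℂ (levelRight G k (Pi.single v 1) ξ) η := by
  simp only [levelInner, PiLp.inner_apply, levelRight, mulBy_apply, Pi.single_apply]
  refine Finset.sum_congr rfl fun β _ => ?_
  split_ifs <;> simp [mul_comm]

open Classical in
theorem fockInner_eq (ξ η : Fock G) (v : V) :
    fockInner G ξ η v = inner ℂ (fockRight G (Pi.single v 1) ξ) η := by
  rw [lp.inner_eq_tsum]
  exact tsum_congr fun k => levelInner_eq G _ _ v

open Classical in
theorem isAdjointable_level_iff {k : ℕ} (T : Level G k →L[ℂ] Level G k) :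
    IsAdjointable (levelInner G) T ↔
      ∀ v ξ, T (levelRight G k (Pi.single v 1) ξ) = levelRight G k (Pi.single v 1) (T ξ) := by
  refine isAdjointable_iff _ (fun v => levelRight G k (Pi.single v 1)) (levelInner_eq G) ?_ T
  intro ξ
  ext β
  simp [levelRight, Pi.single_apply]

open Classical in
theorem isAdjointable_fock_iff (T : Fock G →L[ℂ] Fock G) :
    IsAdjointable (fockInner G) T ↔
      ∀ v ξ, T (fockRight G (Pi.single v 1) ξ) = fockRight G (Pi.single v 1) (T ξ) := by
  refine isAdjointable_iff _ (fun v => fockRight G (Pi.single v 1)) (fockInner_eq G) ?_ T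
  intro ξ
  ext k β
  rw [lp.coeFn_sum, Finset.sum_apply, WithLp.ofLp_sum, Finset.sum_apply]
  simp [Pi.single_apply]

open Classical in
theorem fockRight_adjoint (v : V) :
    star (fockRight G (Pi.single v 1)) = fockRight G (Pi.single v 1) := by
  rw [ContinuousLinearMap.star_eq_adjoint, Eq.comm, ContinuousLinearMap.eq_adjoint_iff]
  intro ξ η
  rw [lp.inner_eq_tsum, lp.inner_eq_tsum]
  refine tsum_congr fun k => ?_
  simp only [PiLp.inner_apply, fockRight_apply, Pi.single_apply]
  refine Finset.sum_congr rfl fun β _ => ?_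
  split_ifs <;> simp

/-- The *-algebra of adjointable operators on the Fock correspondence, inside the bounded operators. -/
def adjointables : StarSubalgebra ℂ (Fock G →L[ℂ] Fock G) where
  carrier := {T | IsAdjointable (fockInner G) T}
  mul_mem' {S T} hS hT := by
    classical
    rw [Set.mem_ofPred_eq, isAdjointable_fock_iff] at *
    intro v ξ
    rw [mul_apply_eq_comp, hT, hS, mul_apply_eq_comp]
  add_mem' {S T} hS hT := by
    classical
    rw [Set.mem_ofPred_eq, isAdjointable_fock_iff] at *
    intro v ξ
    rw [add_apply, hT, hS, add_apply, map_add]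
  algebraMap_mem' c := by
    classical
    rw [Set.mem_ofPred_eq, isAdjointable_fock_iff]
    intro v ξ
    simp [Algebra.algebraMap_eq_smul_one]
  star_mem' {T} hT := by
    classical
    rw [Set.mem_ofPred_eq, isAdjointable_fock_iff] at *
    intro v ξ
    have h : T * fockRight G (Pi.single v 1) = fockRight G (Pi.single v 1) * T := by
      ext1 ξ
      exact hT v ξ
    have h' := congrArg star h
    rw [star_mul, star_mul, fockRight_adjoint] at h'
    exact (DFunLike.congr_fun h' ξ).symm

/-- `ℒ(ℱ(X_E))`: the C*-algebra of adjointable operators on the Fock correspondence. -/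
def Adj : Type _ := adjointables G

instance : NormedRing (Adj G) := inferInstanceAs (NormedRing (adjointables G))

instance : NormedAlgebra ℂ (Adj G) := inferInstanceAs (NormedAlgebra ℂ (adjointables G))

instance : StarRing (Adj G) := inferInstanceAs (StarRing (adjointables G))

instance : CStarRing (Adj G) := inferInstanceAs (CStarRing (adjointables G))

instance : StarModule ℂ (Adj G) := inferInstanceAs (StarModule ℂ (adjointables G))

variable {G} in
/-- An adjointable operator as a bounded operator. -/
def Adj.toCLM (X : Adj G) : Fock G →L[ℂ] Fock G := X.1

theorem diag_mem (T : ∀ k, Level G k →L[ℂ] Level G k) (h : ∃ C, ∀ k, ‖T k‖ ≤ C)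
    (hT : ∀ k, IsAdjointable (levelInner G) (T k)) : diag T h ∈ adjointables G := by
  classical
  refine (isAdjointable_fock_iff G _).2 fun v ξ => ?_
  ext1
  funext k
  exact (isAdjointable_level_iff G (T k)).1 (hT k) v (ξ k)

/-! ### Generalized compact operators and the quotient map -/

/-- `T` is the rank one operator `θ_{ξ,η} : ζ ↦ ξ · ⟨η, ζ⟩`. -/
def IsTheta (ξ η : Fock G) (T : Adj G) : Prop :=
  ∀ ζ, T.toCLM ζ = fockRight G (fockInner G η ζ) ξ

/-- The closed linear span of the operators `θ_{ξ,η}`. -/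
def compactsSubmodule : Submodule ℂ (Adj G) :=
  (Submodule.span ℂ {T | ∃ ξ η, IsTheta G ξ η T}).topologicalClosure


theorem fock_inner_theta (ξ η ζ ζ' : Fock G) :
    inner ℂ ζ (fockRight G (fockInner G η ζ') ξ) =
      inner ℂ (fockRight G (fockInner G ξ ζ) η) ζ' := by
  classical
  have key : ∀ (a : V → ℂ) (x : Fock G),
      fockRight G a x = ∑ v, a v • fockRight G (Pi.single v 1) x := by
    intro a x
    ext k β
    rw [lp.coeFn_sum, Finset.sum_apply, WithLp.ofLp_sum, Finset.sum_apply]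
    simp [Pi.single_apply]
  rw [key _ ξ, key _ η, inner_sum, sum_inner]
  refine Finset.sum_congr rfl fun v _ => ?_
  have h : ∀ x y : Fock G, inner ℂ (fockRight G (Pi.single v 1) x) y =
      inner ℂ x (fockRight G (Pi.single v 1) y) := fun x y => by
    rw [← ContinuousLinearMap.adjoint_inner_right, ← ContinuousLinearMap.star_eq_adjoint,
      fockRight_adjoint]
  rw [inner_smul_right, inner_smul_left, fockInner_eq, fockInner_eq, inner_conj_symm, ← h, mul_comm,
    h ζ ξ]

theorem IsTheta.star {ξ η : Fock G} {T : Adj G} (hT : IsTheta G ξ η T) :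
    IsTheta G η ξ (star T) := by
  intro ζ
  refine ext_inner_right ℂ fun ζ' => ?_
  change inner ℂ (ContinuousLinearMap.adjoint T.toCLM ζ) ζ' = _
  rw [ContinuousLinearMap.adjoint_inner_left, hT ζ', fock_inner_theta]

theorem IsTheta.mul_left {ξ η : Fock G} {T : Adj G} (hT : IsTheta G ξ η T) (X : Adj G) :
    IsTheta G (X.toCLM ξ) η (X * T) := by
  classical
  intro ζ
  have key : ∀ (a : V → ℂ) (x : Fock G),
      fockRight G a x = ∑ v, a v • fockRight G (Pi.single v 1) x := by
    intro a x
    ext k β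
    rw [lp.coeFn_sum, Finset.sum_apply, WithLp.ofLp_sum, Finset.sum_apply]
    simp [Pi.single_apply]
  have hX := (isAdjointable_fock_iff G X.toCLM).1 X.2
  change X.toCLM (T.toCLM ζ) = _
  rw [hT ζ, key _ ξ, key _ (X.toCLM ξ), map_sum]
  refine Finset.sum_congr rfl fun v _ => ?_
  rw [map_smul, hX]

theorem star_mem_compacts {X : Adj G} (hX : X ∈ compactsSubmodule G) :
    star X ∈ compactsSubmodule G := by
  refine map_mem_closure continuous_star hX fun Y hY => ?_
  induction hY using Submodule.span_induction with
  | mem x h =>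
    obtain ⟨ξ, η, h⟩ := h
    exact Submodule.subset_span ⟨η, ξ, h.star⟩
  | zero => simp
  | add x y _ _ hx hy => simpa using add_mem hx hy
  | smul a x _ hx => simpa using Submodule.smul_mem _ _ hx

theorem mul_mem_compacts (Y : Adj G) {X : Adj G} (hX : X ∈ compactsSubmodule G) :
    Y * X ∈ compactsSubmodule G := by
  refine map_mem_closure (f := fun X => Y * X) (continuous_const_mul Y) hX fun Z hZ => ?_
  induction hZ using Submodule.span_induction with
  | mem x h =>
    obtain ⟨ξ, η, h⟩ := h
    exact Submodule.subset_span ⟨_, η, h.mul_left G Y⟩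
  | zero => simp
  | add x y _ _ hx hy => simpa [mul_add] using add_mem hx hy
  | smul a x _ hx => simpa using Submodule.smul_mem _ _ hx

/-- The ideal `𝒦` of generalized compact operators in `ℒ(ℱ(X_E))`. -/
def compacts : Ideal (Adj G) where
  carrier := compactsSubmodule G
  add_mem' := fun h h' => add_mem h h'
  zero_mem' := zero_mem _
  smul_mem' := fun Y _ hX => mul_mem_compacts G Y hX

instance : (compacts G).IsTwoSided where
  mul_mem_of_left {X} Y hX := by
    have h := star_mem_compacts G (mul_mem_compacts G (star Y) (star_mem_compacts G hX))
    rw [star_mul, star_star, star_star] at h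
    exact h

/-- The quotient `ℒ(ℱ(X_E)) / 𝒦`. -/
def Calkin : Type _ := Adj G ⧸ compacts G

instance : Ring (Calkin G) := inferInstanceAs (Ring (Adj G ⧸ compacts G))

instance : Algebra ℂ (Calkin G) := inferInstanceAs (Algebra ℂ (Adj G ⧸ compacts G))

/-- The quotient map `ℒ(ℱ(X_E)) → ℒ(ℱ(X_E)) / 𝒦` as an algebra homomorphism. -/
def qAlg : Adj G →ₐ[ℂ] Calkin G := Ideal.Quotient.mkₐ ℂ (compacts G)

theorem qAlg_surjective : Function.Surjective (qAlg G) :=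
  Ideal.Quotient.mk_surjective

/-- The involution of `ℒ(ℱ(X_E)) / 𝒦`, induced by that of `ℒ(ℱ(X_E))`. -/
instance : Star (Calkin G) where
  star := Quotient.map' star fun X Y h => by
    rw [Submodule.quotientRel_def] at h ⊢
    have h' := star_mem_compacts G h
    rw [star_sub] at h'
    exact h'

theorem star_qAlg (X : Adj G) : star (qAlg G X) = qAlg G (star X) := rfl

instance : StarRing (Calkin G) where
  star_involutive x := by
    obtain ⟨X, rfl⟩ := qAlg_surjective G x
    rw [star_qAlg, star_qAlg, star_star]
  star_mul x y := by
    obtain ⟨X, rfl⟩ := qAlg_surjective G x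
    obtain ⟨Y, rfl⟩ := qAlg_surjective G y
    rw [← map_mul, star_qAlg, star_qAlg, star_qAlg, star_mul, map_mul]
  star_add x y := by
    obtain ⟨X, rfl⟩ := qAlg_surjective G x
    obtain ⟨Y, rfl⟩ := qAlg_surjective G y
    rw [← map_add, star_qAlg, star_qAlg, star_qAlg, star_add, map_add]

/-- The quotient map `q : ℒ(ℱ(X_E)) → ℒ(ℱ(X_E)) / 𝒦`. -/
def q : Adj G →⋆ₐ[ℂ] Calkin G :=
  { qAlg G with map_star' := fun X => (star_qAlg G X).symm }

/-! ### Shifts, weights and the weighted Toeplitz algebra -/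

/-- `ξ ↦ δ_e ⊗ ξ` from `X_E^{⊗ k}` to `X_E^{⊗ (k + 1)}`. -/
def levelShift (e : E) (k : ℕ) : Level G k →ₗ[ℂ] Level G (k + 1) :=
  open Classical in
  { toFun := fun ξ => WithLp.toLp 2 fun γ => if γ.edge 0 = e then ξ γ.tail else 0
    map_add' := fun ξ η => by ext γ; by_cases h : γ.edge 0 = e <;> simp [h]
    map_smul' := fun c ξ => by ext γ; by_cases h : γ.edge 0 = e <;> simp [h] }

theorem norm_levelShift_le (e : E) (k : ℕ) (ξ : Level G k) : ‖levelShift G e k ξ‖ ≤ ‖ξ‖ := by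
  classical
  rw [EuclideanSpace.norm_eq, EuclideanSpace.norm_eq]
  refine Real.sqrt_le_sqrt ?_
  have h1 : ∀ γ : G.Path (k + 1), ‖levelShift G e k ξ γ‖ ^ 2 =
      if γ.edge 0 = e then ‖ξ γ.tail‖ ^ 2 else 0 := fun γ => by
    by_cases h : γ.edge 0 = e <;> simp [levelShift, h]
  simp_rw [h1]
  rw [← Finset.sum_filter]
  have hinj : Set.InjOn (fun γ : G.Path (k + 1) => γ.tail)
      (Finset.univ.filter fun γ : G.Path (k + 1) => γ.edge 0 = e : Finset _) := by
    intro γ hγ γ' hγ' h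
    simp only [Finset.coe_filter, Finset.mem_univ, true_and] at hγ hγ'
    exact DGraph.Path.tail_injOn (hγ.trans hγ'.symm) h
  rw [← Finset.sum_image (f := fun β => ‖ξ β‖ ^ 2) hinj]
  exact Finset.sum_le_sum_of_subset_of_nonneg (Finset.subset_univ _) fun _ _ _ => by positivity

/-- The sequence `(0, δ_e ⊗ ξ₀, δ_e ⊗ ξ₁, …)`. -/
def shiftFun (e : E) (ξ : ∀ k, Level G k) : ∀ k, Level G k
  | 0 => 0
  | k + 1 => levelShift G e k (ξ k)

theorem shift_summable (e : E) (ξ : Fock G) :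
    Summable fun k => ‖shiftFun G e ξ k‖ ^ (2 : ENNReal).toReal := by
  rw [← summable_nat_add_iff 1]
  refine Summable.of_nonneg_of_le (fun k => by positivity) (fun k => ?_)
    ((lp.memℓp ξ).summable (by norm_num))
  exact Real.rpow_le_rpow (norm_nonneg _) (norm_levelShift_le G e k _) (by norm_num)

/-- The shift operator `S_e` on the Fock correspondence, as a bounded operator. -/
def shiftCLM (e : E) : Fock G →L[ℂ] Fock G :=
  LinearMap.mkContinuous
    { toFun := fun ξ => ⟨shiftFun G e ξ, memℓp_gen (shift_summable G e ξ)⟩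
      map_add' := fun ξ η => by
        ext1; funext k
        cases k with
        | zero => exact (add_zero (0 : Level G 0)).symm
        | succ k => exact map_add (levelShift G e k) (ξ k) (η k)
      map_smul' := fun c ξ => by
        ext1; funext k
        cases k with
        | zero => exact (smul_zero (A := Level G 0) c).symm
        | succ k => exact map_smul (levelShift G e k) c (ξ k) }
    1 fun ξ => by
      have hp : 0 < (2 : ENNReal).toReal := by norm_num
      rw [one_mul]
      refine (Real.rpow_le_rpow_iff (norm_nonneg _) (norm_nonneg _) hp).1 ?_
      rw [lp.norm_rpow_eq_tsum hp, lp.norm_rpow_eq_tsum hp]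
      refine (shift_summable G e ξ).tsum_eq_zero_add.trans_le ?_
      have h0 : ‖shiftFun G e ξ 0‖ ^ (2 : ENNReal).toReal = 0 := by simp [shiftFun]
      rw [h0, zero_add]
      refine Summable.tsum_le_tsum (fun k => ?_)
        ((summable_nat_add_iff 1).2 (shift_summable G e ξ)) ((lp.memℓp ξ).summable hp)
      exact Real.rpow_le_rpow (norm_nonneg _) (norm_levelShift_le G e k _) (by norm_num)

theorem shiftCLM_mem (e : E) : shiftCLM G e ∈ adjointables G := by
  classical
  refine (isAdjointable_fock_iff G _).2 fun v ξ => ?_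
  ext k γ
  cases k with
  | zero => exact (mul_zero _).symm
  | succ k =>
    change (if γ.edge 0 = e then _ * ξ k γ.tail else 0) =
      _ * (if γ.edge 0 = e then ξ k γ.tail else 0)
    rw [mul_ite, mul_zero]
    rfl

/-- The shift operator `S_e ∈ ℒ(ℱ(X_E))`, with `S_e δ_β = δ_{eβ}`. -/
def S (e : E) : Adj G := ⟨shiftCLM G e, shiftCLM_mem G e⟩

/-- `S_α = S_{α₁} ⋯ S_{αₙ}` for a path `α = α₁ ⋯ αₙ` of length `n ≥ 1`. -/
def SPath {n : ℕ} (α : G.Path n) : Adj G := (List.ofFn fun i => S G (α.edge i)).prod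

/-- `u_α = q(S_α)` for a path `α` of length `n ≥ 1`. -/
def u {n : ℕ} (α : G.Path n) : Calkin G := q G (SPath G α)

/-- A weight sequence: operators `Z_k ∈ ℒ(X_E^{⊗ k})` commuting with the left action of `A`, with
`Z₀ = I`, uniformly bounded, positive, invertible, and uniformly bounded below for `k ≥ 1`. -/
structure WeightSeq where
  op : ∀ k, Level G k →L[ℂ] Level G k
  adjointable : ∀ k, IsAdjointable (levelInner G) (op k)
  comm_left : ∀ k a, Commute (op k) (levelLeft G k a)
  op_zero : op 0 = 1
  bounded : ∃ C : ℝ, ∀ k, ‖op k‖ ≤ C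
  pos : ∀ k, (op k).IsPositive
  isUnit : ∀ k, IsUnit (op k)
  lower : ∃ ε : ℝ, 0 < ε ∧ ∀ k, 1 ≤ k → (op k - (ε : ℂ) • 1).IsPositive

variable {G}

/-- The weight operator `Z = diag(Z₀, Z₁, …)`. -/
def WeightSeq.Z (Z : WeightSeq G) : Adj G :=
  ⟨diag Z.op Z.bounded, diag_mem G Z.op Z.bounded Z.adjointable⟩

/-- The weighted Toeplitz algebra `𝒯(X_E, Z)`: the C*-algebra generated by the weighted shifts
`W_e = Z S_e`, `e ∈ E¹`. -/
def WeightSeq.T (Z : WeightSeq G) : NonUnitalStarSubalgebra ℂ (Adj G) :=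
  (NonUnitalStarAlgebra.adjoin ℂ (Set.range fun e : E => Z.Z * S G e)).topologicalClosure

/-! ### The gauge action, `𝒟` and `F` -/

theorem norm_phase (j : ℕ) (t : ℝ) : ‖Complex.exp (Complex.I * j * t)‖ = 1 := by
  have : Complex.I * j * t = ((j * t : ℝ) : ℂ) * Complex.I := by push_cast; ring
  rw [this, Complex.norm_exp_ofReal_mul_I]

variable (G) in
/-- The unitary `W_t = ∑ₙ e^{int} Qₙ`, where `Qₙ` is the projection onto the `n`-th summand. -/
def gaugeUnitary (t : ℝ) : Adj G :=
  ⟨diag (fun k => Complex.exp (Complex.I * k * t) • (1 : Level G k →L[ℂ] Level G k))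
      ⟨1, fun k => by
        rw [norm_smul, norm_phase, one_mul]
        exact ContinuousLinearMap.norm_id_le⟩,
    diag_mem G _ _ fun k => by
      classical
      refine (isAdjointable_level_iff G _).2 fun v ξ => ?_
      simp⟩

variable (G) in
/-- The gauge automorphism `γ_t = Ad(W_t)` of `ℒ(ℱ(X_E))`. -/
def gauge (t : ℝ) (X : Adj G) : Adj G := gaugeUnitary G t * X * star (gaugeUnitary G t)

theorem star_gaugeUnitary_mul (t : ℝ) : star (gaugeUnitary G t) * gaugeUnitary G t = 1 := by
  refine Subtype.ext ?_
  refine (ContinuousLinearMap.norm_map_iff_adjoint_comp_self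
    (gaugeUnitary G t).toCLM).1 fun ξ => ?_
  have hp : 0 < (2 : ENNReal).toReal := by norm_num
  rw [lp.norm_eq_tsum_rpow hp, lp.norm_eq_tsum_rpow hp]
  congr 1
  refine tsum_congr fun k => ?_
  change ‖Complex.exp (Complex.I * k * t) • ξ k‖ ^ _ = _
  rw [norm_smul, norm_phase, one_mul]

theorem gauge_mul (t : ℝ) (X Y : Adj G) : gauge G t (X * Y) = gauge G t X * gauge G t Y := by
  have h : gauge G t X * gauge G t Y = gaugeUnitary G t * X *
      (star (gaugeUnitary G t) * gaugeUnitary G t) * Y * star (gaugeUnitary G t) := by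
    simp only [gauge, mul_assoc]
  rw [h, star_gaugeUnitary_mul, mul_one, gauge]
  simp only [mul_assoc]

theorem gauge_add (t : ℝ) (X Y : Adj G) : gauge G t (X + Y) = gauge G t X + gauge G t Y := by
  simp only [gauge, mul_add, add_mul]

theorem gauge_smul (t : ℝ) (c : ℂ) (X : Adj G) : gauge G t (c • X) = c • gauge G t X := by
  simp only [gauge, mul_smul_comm, smul_mul_assoc]

theorem gauge_star (t : ℝ) (X : Adj G) : gauge G t (star X) = star (gauge G t X) := by
  simp only [gauge, star_mul, star_star, mul_assoc]

/-- `𝒟 = {X ∈ 𝒯(X_E, Z) : γ_t(X) = X for all t}`. -/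
def WeightSeq.D (Z : WeightSeq G) : NonUnitalStarSubalgebra ℂ (Adj G) where
  carrier := {X | X ∈ Z.T ∧ ∀ t : ℝ, gauge G t X = X}
  mul_mem' hX hY := ⟨mul_mem hX.1 hY.1, fun t => by rw [gauge_mul, hX.2, hY.2]⟩
  add_mem' hX hY := ⟨add_mem hX.1 hY.1, fun t => by rw [gauge_add, hX.2, hY.2]⟩
  zero_mem' := ⟨zero_mem _, fun t => by simp [gauge]⟩
  smul_mem' c _ hX := ⟨SMulMemClass.smul_mem c hX.1, fun t => by rw [gauge_smul, hX.2]⟩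
  star_mem' hX := ⟨star_mem hX.1, fun t => by rw [gauge_star, hX.2]⟩

/-- `F = {X ∈ 𝒯(X_E, Z) : γ_t(X) = e^{it} X for all t}`. -/
def WeightSeq.F (Z : WeightSeq G) : Submodule ℂ (Adj G) where
  carrier := {X | X ∈ Z.T ∧ ∀ t : ℝ, gauge G t X = Complex.exp (Complex.I * t) • X}
  add_mem' hX hY := ⟨add_mem hX.1 hY.1, fun t => by rw [gauge_add, hX.2, hY.2, smul_add]⟩
  zero_mem' := ⟨zero_mem _, fun t => by simp [gauge]⟩
  smul_mem' c _ hX :=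
    ⟨SMulMemClass.smul_mem c hX.1, fun t => by rw [gauge_smul, hX.2, smul_comm]⟩

/-- The algebra `q(𝒟)`. -/
def WeightSeq.qD (Z : WeightSeq G) : NonUnitalStarSubalgebra ℂ (Calkin G) :=
  NonUnitalStarSubalgebra.map (q G) Z.D

/-- The space `q(Fⁿ)`, where `Fⁿ` is the linear span of the products `a₁ ⋯ aₙ` with `aᵢ ∈ F`. -/
def WeightSeq.qFpow (Z : WeightSeq G) (n : ℕ) : Submodule ℂ (Calkin G) :=
  Submodule.map (q G).toAlgHom.toLinearMap (Z.F ^ n)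

/-- `w : q(𝒟) → q(Fⁿ)` is an isomorphism of correspondences over `q(𝒟)`: a surjective bimodule map
that preserves the inner product. Both inner products are `⟨x, y⟩ = x* y`, and the actions are given
by multiplication in `ℒ(ℱ(X_E)) / 𝒦`. -/
structure WeightSeq.IsCorrespondenceIso (Z : WeightSeq G) (n : ℕ)
    (w : Z.qD →ₗ[ℂ] Z.qFpow n) : Prop where
  surjective : Function.Surjective w
  map_left : ∀ a x : Z.qD, (w (a * x) : Calkin G) = (a : Calkin G) * (w x : Calkin G)
  map_right : ∀ x b : Z.qD, (w (x * b) : Calkin G) = (w x : Calkin G) * (b : Calkin G)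
  map_inner : ∀ x y : Z.qD,
    star (w x : Calkin G) * (w y : Calkin G) = star (x : Calkin G) * (y : Calkin G)

end WCK

end

noncomputable section

namespace WCK

/-! Modulo `compacts`, the sum of all `S e * star (S e)` is the identity, because the difference is
the projection onto level zero. So q(𝒟) has a unit, and an isomorphism w is multiplication by y =
w(1): an isometry in q(Fⁿ) that commutes with q(𝒟) and satisfies q(Fⁿ) = q(𝒟)y
(`exists_isometry_of_iso`). The element 1 - yy* annihilates q(Fⁿ), and this forces yy* = 1
(`mul_star_eq_one_of_generates`).

Nonexistence is then a dimension count. Lift y to an operator Y of degree n. As 1 - YY* is compact,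
it is small on high levels, so star Y maps level k + n injectively into level k for large k. Hence
there are at most as many paths of length k + n as of length k (`eventually_card_path_le`). Without
sinks, deleting the first edge is a surjection from paths of length m + 1 to paths of length m. It
is not injective if a vertex emitting two edges is the range of a path of length m, so the counts
increase strictly, a contradiction. In an irreducible graph without sources or sinks, either two
edges share a source or the graph is a cycle.

For a cycle with an entry the source map is bijective. A path is then determined by its source and
length, so operators of degree zero are diagonal and q(𝒟) is commutative. Given w, each u_α is b y
with b in q(𝒟), hence commutes with q(𝒟). Conversely V = ∑ S_e is unitary modulo compacts and Vⁿ is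
a combination of the S_α, so multiplication by q(V)ⁿ is the required isomorphism.

All this needs the unweighted shifts in the weighted algebra (`S_mem_T`): the weight cut down to
positive levels is the square root of an element of the algebra, and it is bounded below there. -/

namespace DGraph

variable {V E : Type*} {G : DGraph V E}

/-! ### Paths, their number, and cycles -/

/-- The path `e α`, for an edge `e` with `s(e) = r(α)`. -/
def Path.cons {n : ℕ} (e : E) (α : G.Path n) (h : G.s e = α.rng) : G.Path (n + 1) where
  edge := Fin.cons e α.edge
  vert := Fin.cons (G.r e) α.vert
  r_edge i := by
    refine Fin.cases ?_ (fun j => ?_) i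
    · rfl
    · exact α.r_edge j
  s_edge i := by
    refine Fin.cases ?_ (fun j => ?_) i
    · exact h
    · exact α.s_edge j

@[simp]
theorem Path.cons_edge_zero {n : ℕ} (e : E) (α : G.Path n) (h : G.s e = α.rng) :
    (α.cons e h).edge 0 = e := rfl

@[simp]
theorem Path.cons_tail {n : ℕ} (e : E) (α : G.Path n) (h : G.s e = α.rng) :
    (α.cons e h).tail = α := rfl

theorem Path.s_edge_zero {n : ℕ} (α : G.Path (n + 1)) : G.s (α.edge 0) = α.tail.rng :=
  α.s_edge 0

@[simp]
theorem Path.tail_src {n : ℕ} (α : G.Path (n + 1)) : α.tail.src = α.src := rfl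

theorem Path.cons_eq {n : ℕ} (γ : G.Path (n + 1)) (h : G.s (γ.edge 0) = γ.tail.rng) :
    γ.tail.cons (γ.edge 0) h = γ :=
  Path.tail_injOn rfl rfl

/-- If every vertex emits at most one edge, a path is determined by its source and its length. -/
theorem Path.eq_of_src_eq (hs : Function.Injective G.s) {n : ℕ} {α β : G.Path n}
    (h : α.src = β.src) : α = β := by
  induction n with
  | zero =>
    ext i
    · exact i.elim0
    · rw [show i = Fin.last 0 from Fin.ext (by omega)]
      exact h
  | succ n ih =>
    have ht : α.tail = β.tail := ih h
    refine Path.tail_injOn (hs ?_) ht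
    rw [Path.s_edge_zero, Path.s_edge_zero, ht]

theorem Path.tail_surjective (hsink : ∀ v, ¬ G.IsSink v) (n : ℕ) :
    Function.Surjective (Path.tail : G.Path (n + 1) → G.Path n) := fun α => by
  have h := hsink α.rng
  simp only [IsSink, not_forall, not_not] at h
  obtain ⟨e, he⟩ := h
  exact ⟨α.cons e he, rfl⟩

/-- Deleting the first edge is onto, and prepending `e` or `e'` to `α` gives two paths with the same
tail. -/
theorem card_path_lt_succ [Fintype V] [Fintype E] (hsink : ∀ v, ¬ G.IsSink v) {v : V} {e e' : E}
    (hne : e ≠ e') (he : G.s e = v) (he' : G.s e' = v) {n : ℕ} {α : G.Path n} (hα : α.rng = v) :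
    Fintype.card (G.Path n) < Fintype.card (G.Path (n + 1)) := by
  refine Fintype.card_lt_of_surjective_not_injective _ (Path.tail_surjective hsink n) fun hinj => ?_
  have h := @hinj (α.cons e (he.trans hα.symm)) (α.cons e' (he'.trans hα.symm)) rfl
  exact hne (congrArg (fun γ : G.Path (n + 1) => γ.edge 0) h)

theorem IsC.s_bijective {k l : ℕ} (h : G.IsC k l) : Function.Bijective G.s := by
  obtain ⟨-, -, v, e, hs, -⟩ := h
  have : G.s = v ∘ e.symm := funext fun f => by rw [Function.comp_apply, ← hs, e.apply_symm_apply]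
  rw [this]
  exact v.bijective.comp e.symm.bijective

theorem exists_path_of_no_source (h : ∀ v, ¬ G.IsSource v) (v : V) (m : ℕ) :
    ∃ α : G.Path m, α.rng = v := by
  induction m generalizing v with
  | zero => exact ⟨⟨Fin.elim0, fun _ => v, fun i => i.elim0, fun i => i.elim0⟩, rfl⟩
  | succ m ih =>
    have hv := h v
    simp only [IsSource, not_forall, not_not] at hv
    obtain ⟨e, he⟩ := hv
    obtain ⟨α, hα⟩ := ih (G.s e)
    exact ⟨α.cons e hα.symm, he⟩

theorem Path.rng_eq_iterate {f : V → V} (hf : ∀ e, f (G.s e) = G.r e) {n : ℕ} (α : G.Path n) :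
    α.rng = f^[n] α.src := by
  induction n with
  | zero => rfl
  | succ n ih =>
    rw [Function.iterate_succ_apply', ← α.tail_src, ← ih, ← α.s_edge_zero, hf]
    exact (α.r_edge 0).symm

/-- An irreducible graph without sources in which every vertex emits exactly one edge is a cycle. -/
theorem Irreducible.isCycleWithEntry [Finite V] [Nonempty V] (h : G.Irreducible)
    (hsource : ∀ v, ¬ G.IsSource v) (hs : Function.Bijective G.s) : G.IsCycleWithEntry := by
  let sE : E ≃ V := Equiv.ofBijective G.s hs
  have hrs : Function.Surjective (G.r ∘ sE.symm) := by
    refine Function.Surjective.comp (fun v => ?_) sE.symm.surjective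
    simpa [IsSource] using hsource v
  -- Each vertex emits one edge; following it is a surjection of the finite set `V`, as there are no
  -- sources, hence a permutation.
  let σ : Equiv.Perm V := Equiv.ofBijective _ (Finite.injective_iff_bijective.1
    (Finite.injective_iff_surjective.2 hrs))
  have hσ : ∀ e, σ (G.s e) = G.r e := fun e => congrArg G.r (sE.symm_apply_apply e)
  obtain ⟨v₀⟩ := ‹Nonempty V›
  have hreach : ∀ v, ∃ i : ℕ, σ^[i] v₀ = v := by
    intro v
    have hsame : σ.SameCycle v₀ v := by
      rcases h v₀ v with ⟨n, α, h1, h2⟩ | ⟨n, α, h1, h2⟩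
      · refine ⟨n, ?_⟩
        rw [zpow_natCast, ← Equiv.Perm.iterate_eq_pow, ← h1, ← h2, α.rng_eq_iterate hσ]
      · refine Equiv.Perm.SameCycle.symm ⟨n, ?_⟩
        rw [zpow_natCast, ← Equiv.Perm.iterate_eq_pow, ← h1, ← h2, α.rng_eq_iterate hσ]
    obtain ⟨i, hi⟩ := hsame.exists_nat_pow_eq
    exact ⟨i, by rw [Equiv.Perm.iterate_eq_pow, hi]⟩
  -- Irreducibility puts all vertices in one orbit of `σ`, so the graph is the cycle C_{p,1}, with p
  -- the length of that orbit.
  set p := Function.minimalPeriod σ v₀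
  have hpos : 0 < p := Function.IsPeriodicPt.minimalPeriod_pos (orderOf_pos σ) <| by
    rw [Function.IsPeriodicPt, Function.IsFixedPt, Equiv.Perm.iterate_eq_pow, pow_orderOf_eq_one,
      Equiv.Perm.one_apply]
  have hbij : Function.Bijective fun i : Fin p => σ^[i] v₀ := by
    refine ⟨fun i j hij => ?_, fun v => ?_⟩
    · exact Fin.ext (Function.iterate_injOn_Iio_minimalPeriod i.2 j.2 hij)
    · obtain ⟨i, hi⟩ := hreach v
      exact ⟨⟨i % p, Nat.mod_lt _ hpos⟩, by rw [← hi]; exact Function.iterate_mod_minimalPeriod_eq⟩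
  let vE : Fin p ≃ V := Equiv.ofBijective _ hbij
  have hs' : ∀ i, G.s ((vE.trans sE.symm) i) = vE i := fun i => sE.apply_symm_apply (vE i)
  refine ⟨p, 1, le_rfl, hpos, vE, vE.trans sE.symm, hs', fun i j hij => ?_, fun i j hi hj => ?_⟩
  · rw [← hσ, hs']
    change σ (σ^[i] v₀) = σ^[j] v₀
    rw [← hij, Function.iterate_succ_apply']
  · rw [← hσ, hs']
    change σ (σ^[i] v₀) = σ^[j] v₀
    rw [← Function.iterate_succ_apply' (⇑σ), Nat.succ_eq_add_one, hi,
      show (j : ℕ) = 0 by omega]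
    exact Function.iterate_minimalPeriod

end DGraph

variable {V E : Type*} [Fintype V] [Fintype E] {G : DGraph V E}

/-! ### Adjointable operators as bounded operators -/

variable (G) in
/-- The inclusion of the adjointable operators into the bounded operators. -/
def toCLMHom : Adj G →⋆ₐ[ℂ] (Fock G →L[ℂ] Fock G) := (adjointables G).subtype

theorem toCLMHom_apply (X : Adj G) : toCLMHom G X = X.toCLM := rfl

theorem Adj.ext {X Y : Adj G} (h : ∀ ξ, X.toCLM ξ = Y.toCLM ξ) : X = Y :=
  Subtype.ext (ContinuousLinearMap.ext h)

@[simp]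
theorem Adj.mul_apply (X Y : Adj G) (ξ : Fock G) : (X * Y).toCLM ξ = X.toCLM (Y.toCLM ξ) := rfl

@[simp]
theorem Adj.add_apply (X Y : Adj G) (ξ : Fock G) :
    (X + Y).toCLM ξ = X.toCLM ξ + Y.toCLM ξ := rfl

@[simp]
theorem Adj.sub_apply (X Y : Adj G) (ξ : Fock G) :
    (X - Y).toCLM ξ = X.toCLM ξ - Y.toCLM ξ := rfl

@[simp]
theorem Adj.smul_apply (c : ℂ) (X : Adj G) (ξ : Fock G) :
    (c • X).toCLM ξ = c • X.toCLM ξ := rfl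

@[simp]
theorem Adj.one_apply (ξ : Fock G) : (1 : Adj G).toCLM ξ = ξ := rfl

@[simp]
theorem Adj.zero_apply (ξ : Fock G) : (0 : Adj G).toCLM ξ = 0 := rfl

theorem Adj.sum_apply {ι : Type*} (s : Finset ι) (X : ι → Adj G) (ξ : Fock G) :
    (∑ i ∈ s, X i).toCLM ξ = ∑ i ∈ s, (X i).toCLM ξ := by
  rw [← toCLMHom_apply, map_sum, _root_.sum_apply]
  rfl

theorem Adj.inner_star_left (X : Adj G) (ξ η : Fock G) :
    inner ℂ ((star X).toCLM ξ) η = inner ℂ ξ (X.toCLM η) :=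
  ContinuousLinearMap.adjoint_inner_left X.toCLM η ξ

theorem Adj.inner_star_right (X : Adj G) (ξ η : Fock G) :
    inner ℂ ξ ((star X).toCLM η) = inner ℂ (X.toCLM ξ) η :=
  ContinuousLinearMap.adjoint_inner_right X.toCLM ξ η

theorem Adj.norm_apply_le (X : Adj G) (ξ : Fock G) : ‖X.toCLM ξ‖ ≤ ‖X‖ * ‖ξ‖ :=
  X.toCLM.le_opNorm ξ

theorem Adj.norm_le {X : Adj G} {C : ℝ} (hC : 0 ≤ C) (h : ∀ ξ, ‖X.toCLM ξ‖ ≤ C * ‖ξ‖) : ‖X‖ ≤ C :=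
  X.toCLM.opNorm_le_bound hC h

/-! ### The basis vectors and the adjoints of the shifts -/

open Classical in
/-- The basis vector `δ_β` of the Fock correspondence. -/
def pathVec {k : ℕ} (β : G.Path k) : Fock G := lp.single 2 k (EuclideanSpace.single β (1 : ℂ))

theorem inner_pathVec {k : ℕ} (β : G.Path k) (ξ : Fock G) : inner ℂ (pathVec β) ξ = ξ k β := by
  classical
  rw [pathVec, lp.inner_single_left, EuclideanSpace.inner_single_left]
  simp

theorem S_apply_zero (e : E) (ξ : Fock G) : (S G e).toCLM ξ 0 = 0 := rfl

open Classical in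
theorem S_apply_succ (e : E) (ξ : Fock G) (k : ℕ) (γ : G.Path (k + 1)) :
    (S G e).toCLM ξ (k + 1) γ = if γ.edge 0 = e then ξ k γ.tail else 0 := rfl

open Classical in
theorem pathVec_apply {k : ℕ} (β γ : G.Path k) : pathVec β k γ = if γ = β then 1 else 0 := by
  rw [pathVec, lp.single_apply_self]
  simp

theorem pathVec_apply_ne {k m : ℕ} (β : G.Path k) (h : m ≠ k) : pathVec β m = 0 := by
  rw [pathVec, lp.single_apply_ne _ _ _ h]

theorem S_pathVec {k : ℕ} (e : E) (β : G.Path k) (h : G.s e = β.rng) :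
    (S G e).toCLM (pathVec β) = pathVec (β.cons e h) := by
  classical
  ext m γ
  cases m with
  | zero => rw [S_apply_zero, pathVec_apply_ne _ (Nat.succ_ne_zero k).symm]
  | succ m =>
    rw [S_apply_succ]
    by_cases hm : m = k
    · subst hm
      rw [pathVec_apply, pathVec_apply]
      by_cases h1 : γ = β.cons e h
      · subst h1; simp
      · rw [if_neg h1]
        split_ifs with h2 h3
        · exact absurd (DGraph.Path.tail_injOn (h2.trans rfl) (h3.trans rfl)) h1
        · rfl
        · rfl
    · rw [pathVec_apply_ne _ hm, pathVec_apply_ne _ (by omega)]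
      simp

theorem S_pathVec_eq_zero {k : ℕ} (e : E) (β : G.Path k) (h : G.s e ≠ β.rng) :
    (S G e).toCLM (pathVec β) = 0 := by
  classical
  ext m γ
  cases m with
  | zero => rw [S_apply_zero]; rfl
  | succ m =>
    rw [S_apply_succ]
    by_cases hm : m = k
    · subst hm
      rw [pathVec_apply]
      split_ifs with h2 h3
      · exact absurd (by rw [← h2, γ.s_edge_zero, h3]) h
      · rfl
      · rfl
    · rw [pathVec_apply_ne _ hm]
      simp

theorem star_S_apply {k : ℕ} (e : E) (ξ : Fock G) (β : G.Path k) (h : G.s e = β.rng) :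
    (star (S G e)).toCLM ξ k β = ξ (k + 1) (β.cons e h) := by
  rw [← inner_pathVec, Adj.inner_star_right, S_pathVec e β h, inner_pathVec]

theorem star_S_apply_eq_zero {k : ℕ} (e : E) (ξ : Fock G) (β : G.Path k) (h : G.s e ≠ β.rng) :
    (star (S G e)).toCLM ξ k β = 0 := by
  rw [← inner_pathVec, Adj.inner_star_right, S_pathVec_eq_zero e β h, inner_zero_left]

/-- The operator `∑ₑ Sₑ Sₑ*`. -/
def rangeSum (G : DGraph V E) : Adj G := ∑ e, S G e * star (S G e)

theorem rangeSum_apply_zero (ξ : Fock G) : (rangeSum G).toCLM ξ 0 = 0 := by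
  rw [rangeSum, Adj.sum_apply, lp.coeFn_sum, Finset.sum_apply]
  exact Finset.sum_eq_zero fun e _ => S_apply_zero e _

/-- A path of positive length has exactly one first edge, so a single summand contributes. Thus
`rangeSum` is the projection onto the positive levels. -/
theorem rangeSum_apply_succ (ξ : Fock G) (k : ℕ) : (rangeSum G).toCLM ξ (k + 1) = ξ (k + 1) := by
  classical
  ext γ
  rw [rangeSum, Adj.sum_apply, lp.coeFn_sum, Finset.sum_apply, WithLp.ofLp_sum, Finset.sum_apply]
  simp only [Adj.mul_apply, S_apply_succ, Finset.sum_ite_eq, Finset.mem_univ, if_true]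
  rw [star_S_apply _ _ _ γ.s_edge_zero, DGraph.Path.cons_eq]

theorem rangeSum_mul_S (e : E) : rangeSum G * S G e = S G e := by
  refine Adj.ext fun ξ => ?_
  ext1; funext k
  cases k with
  | zero => rw [Adj.mul_apply, rangeSum_apply_zero, S_apply_zero]
  | succ k => rw [Adj.mul_apply, rangeSum_apply_succ]

theorem star_S_mul_S_of_ne {e f : E} (h : e ≠ f) : star (S G e) * S G f = 0 := by
  classical
  refine Adj.ext fun ξ => ?_
  ext k β
  rw [Adj.mul_apply]
  by_cases hβ : G.s e = β.rng
  · rw [star_S_apply _ _ _ hβ, S_apply_succ, DGraph.Path.cons_edge_zero, if_neg h]; rfl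
  · rw [star_S_apply_eq_zero _ _ _ hβ]; rfl

theorem S_mul_S_eq_zero {e f : E} (h : G.s e ≠ G.r f) : S G e * S G f = 0 := by
  classical
  refine Adj.ext fun ξ => ?_
  ext k γ
  rw [Adj.mul_apply]
  cases k with
  | zero => rw [S_apply_zero]; rfl
  | succ k =>
    rw [S_apply_succ]
    cases k with
    | zero => rw [S_apply_zero]; simp
    | succ k =>
      rw [S_apply_succ]
      split_ifs with h1 h2
      · refine absurd ?_ h
        rw [← h1, ← h2, γ.s_edge_zero]
        exact (γ.tail.r_edge 0).symm
      · rfl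
      · rfl

/-- Each summand projects onto the paths with range `G.s e`; since the source map is bijective,
every path is counted once. -/
theorem sum_star_S_mul_S (hs : Function.Bijective G.s) : ∑ e, star (S G e) * S G e = 1 := by
  classical
  refine Adj.ext fun ξ => ?_
  ext k β
  rw [Adj.sum_apply, lp.coeFn_sum, Finset.sum_apply, WithLp.ofLp_sum, Finset.sum_apply]
  obtain ⟨e, he⟩ := hs.2 β.rng
  rw [Finset.sum_eq_single e]
  · rw [Adj.mul_apply, star_S_apply _ _ _ he, S_apply_succ, DGraph.Path.cons_edge_zero, if_pos rfl,
      DGraph.Path.cons_tail, Adj.one_apply]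
  · intro f _ hf
    rw [Adj.mul_apply, star_S_apply_eq_zero]
    exact fun h => hf (hs.1 (h.trans he.symm))
  · simp

/-- A nonzero product would need a path whose range is the source of both `e` and `f`. -/
theorem S_mul_star_S_of_ne (hs : Function.Injective G.s) {e f : E} (h : e ≠ f) :
    S G e * star (S G f) = 0 := by
  classical
  refine Adj.ext fun ξ => ?_
  ext k γ
  rw [Adj.mul_apply]
  cases k with
  | zero => rw [S_apply_zero]; rfl
  | succ k =>
    rw [S_apply_succ]
    split_ifs with h1
    · rw [star_S_apply_eq_zero]
      · rfl
      · rw [← γ.s_edge_zero, h1]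
        exact fun h2 => h (hs h2.symm)
    · rfl

/-! ### The sum of the shifts: an isometry, unitary modulo compacts -/

/-- The sum of all the shifts. -/
def shiftSum (G : DGraph V E) : Adj G := ∑ e, S G e

theorem star_shiftSum_mul_shiftSum (hs : Function.Bijective G.s) :
    star (shiftSum G) * shiftSum G = 1 := by
  classical
  rw [shiftSum, star_sum, Finset.sum_mul_sum, ← sum_star_S_mul_S hs]
  refine Finset.sum_congr rfl fun e _ => ?_
  exact Finset.sum_eq_single e (fun f _ hf => star_S_mul_S_of_ne hf.symm) (by simp)

theorem shiftSum_mul_star_shiftSum (hs : Function.Injective G.s) :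
    shiftSum G * star (shiftSum G) = rangeSum G := by
  classical
  rw [shiftSum, star_sum, Finset.sum_mul_sum, rangeSum]
  refine Finset.sum_congr rfl fun e _ => ?_
  exact Finset.sum_eq_single e (fun f _ hf => S_mul_star_S_of_ne hs hf.symm) (by simp)

theorem S_mul_SPath {n : ℕ} (e : E) (α : G.Path n) (h : G.s e = α.rng) :
    S G e * SPath G α = SPath G (α.cons e h) := by
  rw [SPath, SPath, List.ofFn_succ, List.prod_cons]
  rfl

/-- The power expands into words in the edges, and a word that is not a path gives zero. -/
theorem shiftSum_pow_mem_span (n : ℕ) :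
    shiftSum G ^ (n + 1) ∈ Submodule.span ℂ (Set.range (SPath G : G.Path (n + 1) → Adj G)) := by
  induction n with
  | zero =>
    rw [zero_add, pow_one]
    refine Submodule.sum_mem _ fun e _ => Submodule.subset_span ?_
    let α : G.Path 0 := ⟨Fin.elim0, fun _ => G.s e, fun i => i.elim0, fun i => i.elim0⟩
    exact ⟨α.cons e rfl, (S_mul_SPath e α rfl).symm.trans (mul_one _)⟩
  | succ n ih =>
    rw [pow_succ', shiftSum, Finset.sum_mul]
    refine Submodule.sum_mem _ fun e _ => ?_
    rw [← shiftSum]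
    generalize shiftSum G ^ (n + 1) = y at ih ⊢
    induction ih using Submodule.span_induction with
    | mem x hx =>
      obtain ⟨α, rfl⟩ := hx
      by_cases h : G.s e = α.rng
      · exact Submodule.subset_span ⟨α.cons e h, (S_mul_SPath e α h).symm⟩
      · have h0 : S G e * SPath G α = 0 := by
          rw [SPath, List.ofFn_succ, List.prod_cons, ← mul_assoc, S_mul_S_eq_zero, zero_mul]
          rw [α.r_edge 0]
          exact h
        rw [h0]
        exact zero_mem _
    | zero => simp
    | add x y _ _ hx hy => rw [mul_add]; exact add_mem hx hy
    | smul c x _ hx => rw [mul_smul_comm]; exact Submodule.smul_mem _ _ hx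

/-! ### The shifts belong to the weighted Toeplitz algebra -/

theorem Z_apply (Z : WeightSeq G) (ξ : Fock G) (k : ℕ) : Z.Z.toCLM ξ k = Z.op k (ξ k) := rfl

theorem inner_Z_left (Z : WeightSeq G) (ξ η : Fock G) :
    inner ℂ (Z.Z.toCLM ξ) η = inner ℂ ξ (Z.Z.toCLM η) := by
  rw [lp.inner_eq_tsum, lp.inner_eq_tsum]
  exact tsum_congr fun k => (Z.pos k).isSymmetric (ξ k) (η k)

theorem star_Z (Z : WeightSeq G) : star Z.Z = Z.Z := by
  refine Adj.ext fun ξ => ext_inner_right ℂ fun η => ?_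
  rw [Adj.inner_star_left, inner_Z_left]

theorem star_rangeSum : star (rangeSum G) = rangeSum G := by
  simp only [rangeSum, star_sum, star_mul, star_star]

theorem rangeSum_mul_self : rangeSum G * rangeSum G = rangeSum G := by
  conv_lhs => enter [2]; rw [rangeSum]
  simp only [Finset.mul_sum, ← mul_assoc, rangeSum_mul_S]
  rfl

theorem rangeSum_mul_Z (Z : WeightSeq G) : rangeSum G * Z.Z = Z.Z * rangeSum G := by
  refine Adj.ext fun ξ => ?_
  ext1; funext k
  rw [Adj.mul_apply, Adj.mul_apply, Z_apply]
  cases k with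
  | zero => rw [rangeSum_apply_zero, rangeSum_apply_zero, map_zero]
  | succ k => rw [rangeSum_apply_succ, rangeSum_apply_succ, Z_apply]

/-- The weight operator cut down to the orthogonal complement of the zeroth level. -/
def WeightSeq.cutZ (Z : WeightSeq G) : Adj G := rangeSum G * Z.Z

/-- The right-hand side visibly lies in `Z.T`; a square root then puts `cutZ` there. -/
theorem cutZ_mul_self (Z : WeightSeq G) :
    Z.cutZ * Z.cutZ = ∑ e, (Z.Z * S G e) * star (Z.Z * S G e) := by
  have h : ∀ e, (Z.Z * S G e) * star (Z.Z * S G e) = Z.Z * (S G e * star (S G e)) * Z.Z := fun e => by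
    rw [star_mul, star_Z]; simp only [mul_assoc]
  simp_rw [h]
  rw [← Finset.sum_mul, ← Finset.mul_sum, ← rangeSum, WeightSeq.cutZ]
  nth_rewrite 1 [rangeSum_mul_Z]
  rw [mul_assoc, ← mul_assoc (rangeSum G), rangeSum_mul_self, ← mul_assoc]

theorem cutZ_mul_S (Z : WeightSeq G) (e : E) : Z.cutZ * S G e = Z.Z * S G e := by
  rw [WeightSeq.cutZ, rangeSum_mul_Z, mul_assoc, rangeSum_mul_S]

theorem cutZ_apply_zero (Z : WeightSeq G) (ξ : Fock G) : Z.cutZ.toCLM ξ 0 = 0 :=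
  rangeSum_apply_zero _

theorem cutZ_apply_succ (Z : WeightSeq G) (ξ : Fock G) (k : ℕ) :
    Z.cutZ.toCLM ξ (k + 1) = Z.op (k + 1) (ξ (k + 1)) := by
  rw [WeightSeq.cutZ, Adj.mul_apply, rangeSum_apply_succ, Z_apply]

theorem cutZ_isPositive (Z : WeightSeq G) : Z.cutZ.toCLM.IsPositive := by
  have hstar : star Z.cutZ = Z.cutZ := by
    rw [WeightSeq.cutZ, star_mul, star_Z, star_rangeSum, rangeSum_mul_Z]
  refine ⟨fun ξ η => ?_, fun ξ => ?_⟩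
  · change inner ℂ (Z.cutZ.toCLM ξ) η = inner ℂ ξ (Z.cutZ.toCLM η)
    rw [← Adj.inner_star_left, hstar]
  · rw [ContinuousLinearMap.reApplyInnerSelf_apply, lp.inner_eq_tsum, RCLike.re_tsum]
    · refine tsum_nonneg fun k => ?_
      cases k with
      | zero => simp [cutZ_apply_zero]
      | succ k =>
        rw [cutZ_apply_succ]
        exact (Z.pos (k + 1)).re_inner_nonneg_left _
    · exact lp.summable_inner _ _

theorem T_isClosed (Z : WeightSeq G) : IsClosed (Z.T : Set (Adj G)) :=
  NonUnitalStarSubalgebra.isClosed_topologicalClosure _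

theorem Z_mul_S_mem_T (Z : WeightSeq G) (e : E) : Z.Z * S G e ∈ Z.T :=
  NonUnitalStarSubalgebra.le_topologicalClosure _ (NonUnitalStarAlgebra.subset_adjoin ℂ _ ⟨e, rfl⟩)

/-- The square root vanishes at 0, so the non-unital functional calculus of `a * a` stays inside
`B`. -/
theorem mem_of_isPositive_of_mul_self_mem {H : Type*} [NormedAddCommGroup H]
    [InnerProductSpace ℂ H] [CompleteSpace H] {B : NonUnitalStarSubalgebra ℂ (H →L[ℂ] H)}
    (hB : IsClosed (B : Set (H →L[ℂ] H))) {a : H →L[ℂ] H} (ha : a.IsPositive) (h : a * a ∈ B) :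
    a ∈ B := by
  have ha0 : 0 ≤ a := (ContinuousLinearMap.nonneg_iff_isPositive _).2 ha
  rw [← CFC.sqrt_mul_self a ha0,
    CFC.sqrt_eq_real_sqrt _ ((IsSelfAdjoint.of_nonneg ha0).mul_self_nonneg)]
  exact cfcₙ_mem (𝕜' := ℂ) (hs := hB) _ h

/-- If the square of a positive adjointable operator lies in a closed *-subalgebra, so does the
operator. -/
theorem mem_of_mul_self_mem {B : NonUnitalStarSubalgebra ℂ (Adj G)}
    (hB : IsClosed (B : Set (Adj G))) {R : Adj G} (hR : R.toCLM.IsPositive) (h : R * R ∈ B) :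
    R ∈ B := by
  -- The functional calculus is applied among all bounded operators, to the closure of the image of
  -- `B`. As the adjointables carry the subspace topology, membership in that closure pulls back to
  -- the closure of `B`.
  let B' : NonUnitalStarSubalgebra ℂ (Fock G →L[ℂ] Fock G) :=
    (NonUnitalStarSubalgebra.map (toCLMHom G) B).topologicalClosure
  have hcl : IsClosed (B' : Set (Fock G →L[ℂ] Fock G)) :=
    NonUnitalStarSubalgebra.isClosed_topologicalClosure _
  have hsq : R.toCLM * R.toCLM ∈ B' :=
    NonUnitalStarSubalgebra.le_topologicalClosure _ ⟨R * R, h, rfl⟩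
  have hmem : R.toCLM ∈ B' := mem_of_isPositive_of_mul_self_mem hcl hR hsq
  have hind : Topology.IsInducing (Subtype.val : adjointables G → (Fock G →L[ℂ] Fock G)) :=
    Topology.IsInducing.subtypeVal
  have : (R : Adj G) ∈ closure (B : Set (Adj G)) := by
    have h2 := hind.closure_eq_preimage_closure_image (B : Set (Adj G))
    rw [show closure (B : Set (Adj G)) = _ from h2]
    exact hmem
  rwa [hB.closure_eq] at this

theorem cutZ_mem_T (Z : WeightSeq G) : Z.cutZ ∈ Z.T := by
  refine mem_of_mul_self_mem (T_isClosed Z) (cutZ_isPositive Z) ?_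
  rw [cutZ_mul_self]
  exact sum_mem fun e _ => mul_mem (Z_mul_S_mem_T Z e) (star_mem (Z_mul_S_mem_T Z e))

theorem exists_le_inner_cutZ (Z : WeightSeq G) : ∃ ε : ℝ, 0 < ε ∧ ∀ ξ : Fock G, ξ 0 = 0 →
    ε * ‖ξ‖ ^ 2 ≤ (inner ℂ (Z.cutZ.toCLM ξ) ξ).re := by
  obtain ⟨ε, hε, h⟩ := Z.lower
  refine ⟨ε, hε, fun ξ hξ => ?_⟩
  have h1 : ε * ‖ξ‖ ^ 2 = (inner ℂ ((ε : ℂ) • ξ) ξ).re := by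
    rw [inner_smul_left, Complex.conj_ofReal, Complex.re_ofReal_mul, inner_self_eq_norm_sq_to_K]
    norm_cast
  rw [h1, ← sub_nonneg, ← Complex.sub_re, ← inner_sub_left, lp.inner_eq_tsum, ← RCLike.re_eq_complex_re,
    RCLike.re_tsum]
  · refine tsum_nonneg fun k => ?_
    cases k with
    | zero => rw [hξ]; simp
    | succ k =>
      have h2 := (h (k + 1) (by omega)).re_inner_nonneg_left (ξ (k + 1))
      rw [lp.coeFn_sub, Pi.sub_apply, cutZ_apply_succ]
      exact h2
  · exact lp.summable_inner _ _

/-- With `ε` a lower bound and `C` an upper bound for `cutZ` on positive levels, expanding the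
square gives the factor 1 - 2cε + c²C². It is minimal at c = ε / C², with value 1 - ε² / C². -/
theorem exists_norm_sub_cutZ_le (Z : WeightSeq G) : ∃ c ρ : ℝ, 0 ≤ ρ ∧ ρ < 1 ∧
    ∀ ξ : Fock G, ξ 0 = 0 → ‖ξ - (c : ℂ) • Z.cutZ.toCLM ξ‖ ^ 2 ≤ ρ * ‖ξ‖ ^ 2 := by
  obtain ⟨ε, hε, h⟩ := exists_le_inner_cutZ Z
  -- Adding `ε` makes `C` positive and at least `ε`, so that the contraction factor is nonnegative.
  set C : ℝ := ‖Z.cutZ‖ + ε with hC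
  have hC0 : ε ≤ C := le_add_of_nonneg_left (norm_nonneg _)
  have hCpos : 0 < C := hε.trans_le hC0
  refine ⟨ε / C ^ 2, 1 - ε ^ 2 / C ^ 2, ?_, ?_, fun ξ hξ => ?_⟩
  · rw [sub_nonneg, div_le_one (by positivity)]
    gcongr
  · rw [sub_lt_self_iff]; positivity
  · set η := Z.cutZ.toCLM ξ with hη
    have h1 : ‖η‖ ≤ C * ‖ξ‖ :=
      (Adj.norm_apply_le _ _).trans (by gcongr; linarith)
    have h2 : ε * ‖ξ‖ ^ 2 ≤ (inner ℂ ξ η).re := by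
      rw [← inner_conj_symm, Complex.conj_re]
      exact h ξ hξ
    rw [@norm_sub_sq ℂ, inner_smul_right, norm_smul, Complex.norm_real, RCLike.re_eq_complex_re,
      Complex.re_ofReal_mul, Real.norm_of_nonneg (by positivity), mul_pow]
    have h3 : (ε / C ^ 2) ^ 2 * ‖η‖ ^ 2 ≤ (ε / C ^ 2) ^ 2 * (C * ‖ξ‖) ^ 2 := by gcongr
    have h4 : ε / C ^ 2 * (ε * ‖ξ‖ ^ 2) ≤ ε / C ^ 2 * (inner ℂ ξ η).re := by gcongr
    have h5 : (ε / C ^ 2) ^ 2 * (C * ‖ξ‖) ^ 2 = ε ^ 2 / C ^ 2 * ‖ξ‖ ^ 2 := by field_simp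
    have h6 : ε / C ^ 2 * (ε * ‖ξ‖ ^ 2) = ε ^ 2 / C ^ 2 * ‖ξ‖ ^ 2 := by field_simp
    linarith

/-- Inversion of `cutZ` on the positive levels by iteration: `X j` tends to zero geometrically,
while `S G e - X j` is a polynomial in `cutZ` without constant term, times `S G e`. It lies in `Z.T`
because `cutZ * S G e` is the weighted shift. -/
theorem S_mem_T (Z : WeightSeq G) (e : E) : S G e ∈ Z.T := by
  obtain ⟨c, ρ, hρ0, hρ1, h⟩ := exists_norm_sub_cutZ_le Z
  let X : ℕ → Adj G := fun j => (1 - (c : ℂ) • Z.cutZ) ^ j * S G e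
  have hX : ∀ j, X (j + 1) = X j - (c : ℂ) • (Z.cutZ * X j) := fun j => by
    simp only [X]
    rw [pow_succ', mul_assoc, sub_mul, one_mul, smul_mul_assoc]
  -- The contraction estimate holds only for vectors without component in level zero.
  have hzero : ∀ j ξ, (X j).toCLM ξ 0 = 0 := by
    intro j
    induction j with
    | zero =>
      intro ξ
      simp only [X, pow_zero, one_mul]
      exact S_apply_zero e ξ
    | succ j ih =>
      intro ξ
      rw [hX, Adj.sub_apply, lp.coeFn_sub, Pi.sub_apply, ih, Adj.smul_apply, lp.coeFn_smul,
        Pi.smul_apply, Adj.mul_apply, cutZ_apply_zero, smul_zero, sub_zero]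
  have hmem : ∀ j, S G e - X j ∈ Z.T := by
    intro j
    induction j with
    | zero => simp [X]
    | succ j ih =>
      have : S G e - X (j + 1) =
          (S G e - X j) + (c : ℂ) • (Z.Z * S G e - Z.cutZ * (S G e - X j)) := by
        rw [hX, mul_sub, cutZ_mul_S, sub_sub_cancel]; abel
      rw [this]
      exact add_mem ih (SMulMemClass.smul_mem _
        (sub_mem (Z_mul_S_mem_T Z e) (mul_mem (cutZ_mem_T Z) ih)))
  have hnorm : ∀ j ξ, ‖(X j).toCLM ξ‖ ^ 2 ≤ ρ ^ j * (‖S G e‖ * ‖ξ‖) ^ 2 := by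
    intro j ξ
    induction j with
    | zero =>
      simp only [X, pow_zero, one_mul]
      gcongr
      exact Adj.norm_apply_le _ _
    | succ j ih =>
      rw [hX]
      refine (h _ (hzero j ξ)).trans ?_
      rw [pow_succ' ρ, mul_assoc]
      gcongr
  have hnorm' : ∀ j, ‖X j‖ ≤ √ρ ^ j * ‖S G e‖ := by
    intro j
    refine Adj.norm_le (by positivity) fun ξ => ?_
    refine le_of_sq_le_sq ?_ (by positivity)
    refine (hnorm j ξ).trans_eq ?_
    rw [mul_assoc, mul_pow (√ρ ^ j), ← pow_mul, mul_comm j 2, pow_mul, Real.sq_sqrt hρ0]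
  have hlim : Filter.Tendsto X Filter.atTop (nhds 0) := by
    refine squeeze_zero_norm hnorm' ?_
    have h0 : √ρ < 1 := by rw [Real.sqrt_lt' one_pos]; simpa using hρ1
    simpa using (tendsto_pow_atTop_nhds_zero_of_lt_one (Real.sqrt_nonneg ρ) h0).mul_const ‖S G e‖
  have hlim' : Filter.Tendsto (fun j => S G e - X j) Filter.atTop (nhds (S G e)) := by
    simpa using tendsto_const_nhds.sub hlim
  exact (T_isClosed Z).mem_of_tendsto hlim' (Filter.Eventually.of_forall hmem)

/-! ### Generalized compact operators -/

-- Level zero is a copy of A = c(E⁰), and the constant function 1 is the unit of A; so θ_{1,1} is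
-- the projection onto level zero.
open Classical in
theorem isTheta_one_sub_rangeSum :
    IsTheta G (lp.single 2 0 (WithLp.toLp 2 fun _ => 1)) (lp.single 2 0 (WithLp.toLp 2 fun _ => 1))
      (1 - rangeSum G) := by
  intro ζ
  set ξ : Fock G := lp.single 2 0 (WithLp.toLp 2 fun _ => 1) with hξ
  ext k β
  rw [Adj.sub_apply, Adj.one_apply, fockRight_apply, lp.coeFn_sub, Pi.sub_apply]
  cases k with
  | zero =>
    have h1 : fockInner G ξ ζ β.src = ζ 0 β := by
      rw [fockInner, tsum_eq_single 0]
      · rw [levelInner, Finset.sum_eq_single β]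
        · rw [hξ, lp.single_apply_self]; simp
        · intro γ _ hγ
          refine if_neg fun h => hγ ?_
          ext i
          · exact i.elim0
          · rw [show i = Fin.last 0 from Fin.ext (by omega)]; exact h
        · simp
      · intro k hk
        rw [hξ, lp.single_apply_ne _ _ _ hk]
        simp [levelInner]
    rw [rangeSum_apply_zero, h1, hξ, lp.single_apply_self]
    simp
  | succ k =>
    rw [rangeSum_apply_succ, hξ, lp.single_apply_ne _ _ _ (Nat.succ_ne_zero k)]
    simp

theorem one_sub_rangeSum_mem_compacts : 1 - rangeSum G ∈ compacts G :=
  Submodule.le_topologicalClosure _ (Submodule.subset_span ⟨_, _, isTheta_one_sub_rangeSum⟩)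

theorem norm_levelRight_apply_le {k : ℕ} (a : V → ℂ) (x : Level G k) :
    ‖levelRight G k a x‖ ≤ ‖a‖ * ‖x‖ :=
  (levelRight G k a).le_of_opNorm_le
    (norm_mulBy_le G _ _ (norm_nonneg _) fun β => norm_le_pi_norm a β.src) x

theorem norm_fockRight_apply_le (a : V → ℂ) (ξ : Fock G) : ‖fockRight G a ξ‖ ≤ ‖a‖ * ‖ξ‖ := by
  have key : ‖(‖a‖ : ℂ) • ξ‖ = ‖a‖ * ‖ξ‖ := by
    rw [norm_smul, Complex.norm_real, norm_norm]
  rw [← key]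
  refine lp.norm_mono (by norm_num) fun k => ?_
  rw [lp.coeFn_smul, Pi.smul_apply, norm_smul, Complex.norm_real, norm_norm]
  exact norm_levelRight_apply_le a (ξ k)

theorem norm_fockInner_single_le (η : Fock G) (k : ℕ) (x : Level G k) :
    ‖fockInner G η (lp.single 2 k x)‖ ≤ ‖η k‖ * ‖x‖ := by
  classical
  refine (pi_norm_le_iff_of_nonneg (by positivity)).2 fun v => ?_
  rw [fockInner_eq, lp.inner_single_right]
  refine (norm_inner_le_norm _ _).trans ?_
  gcongr
  refine (norm_levelRight_apply_le (Pi.single v 1) (η k)).trans ?_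
  have h : ‖(Pi.single v 1 : V → ℂ)‖ ≤ 1 :=
    (pi_norm_le_iff_of_nonneg zero_le_one).2 fun w => by
      rw [Pi.single_apply]; split_ifs <;> simp
  exact mul_le_of_le_one_left (norm_nonneg _) h

theorem tendsto_norm_apply (η : Fock G) : Filter.Tendsto (fun k => ‖η k‖) Filter.atTop (nhds 0) := by
  have h := ((lp.memℓp η).summable (by norm_num)).tendsto_atTop_zero
  have h2 := h.sqrt
  simpa [Real.sqrt_sq] using h2

/-- A generalized compact operator is small on the levels of large index. -/
theorem eventually_norm_le_of_mem_compacts {X : Adj G} (hX : X ∈ compacts G) {ε : ℝ} (hε : 0 < ε) :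
    ∀ᶠ k in Filter.atTop, ∀ x : Level G k, ‖X.toCLM (lp.single 2 k x)‖ ≤ ε * ‖x‖ := by
  have hspan : ∀ Y ∈ Submodule.span ℂ {T | ∃ ξ η, IsTheta G ξ η T}, ∀ ε : ℝ, 0 < ε →
      ∀ᶠ k in Filter.atTop, ∀ x : Level G k, ‖Y.toCLM (lp.single 2 k x)‖ ≤ ε * ‖x‖ := by
    intro Y hY
    induction hY using Submodule.span_induction with
    | mem T hT =>
      obtain ⟨ξ, η, hT⟩ := hT
      intro ε hε
      -- On level `k` only `η k` enters θ_{ξ,η}, so its norm there is at most `‖η k‖ * ‖ξ‖`.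
      have h : Filter.Tendsto (fun k => ‖η k‖ * ‖ξ‖) Filter.atTop (nhds 0) := by
        simpa using (tendsto_norm_apply η).mul_const ‖ξ‖
      filter_upwards [h.eventually_le_const hε] with k hk x
      rw [hT]
      calc _ ≤ ‖fockInner G η (lp.single 2 k x)‖ * ‖ξ‖ := norm_fockRight_apply_le _ _
        _ ≤ ‖η k‖ * ‖x‖ * ‖ξ‖ := by gcongr; exact norm_fockInner_single_le η k x
        _ = ‖η k‖ * ‖ξ‖ * ‖x‖ := by ring
        _ ≤ ε * ‖x‖ := by gcongr
    | zero =>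
      intro ε hε
      refine Filter.Eventually.of_forall fun k x => ?_
      rw [Adj.zero_apply, norm_zero]
      positivity
    | add A B _ _ hA hB =>
      intro ε hε
      filter_upwards [hA (ε / 2) (by positivity), hB (ε / 2) (by positivity)] with k h1 h2 x
      rw [Adj.add_apply]
      have := norm_add_le (A.toCLM (lp.single 2 k x)) (B.toCLM (lp.single 2 k x))
      linarith [h1 x, h2 x]
    | smul c A _ hA =>
      intro ε hε
      filter_upwards [hA (ε / (‖c‖ + 1)) (by positivity)] with k h1 x
      rw [Adj.smul_apply, norm_smul]
      calc _ ≤ (‖c‖ + 1) * (ε / (‖c‖ + 1) * ‖x‖) := by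
            gcongr
            · linarith
            · exact h1 x
        _ = ε * ‖x‖ := by field_simp
  obtain ⟨Y, hY, hXY⟩ := Metric.mem_closure_iff.1
    (show X ∈ closure (Submodule.span ℂ {T | ∃ ξ η, IsTheta G ξ η T} : Set (Adj G)) from hX)
    (ε / 2) (by positivity)
  filter_upwards [hspan Y hY (ε / 2) (by positivity)] with k hk x
  have h1 : X.toCLM (lp.single 2 k x) =
      (X - Y).toCLM (lp.single 2 k x) + Y.toCLM (lp.single 2 k x) := by
    rw [Adj.sub_apply, sub_add_cancel]
  have h2 := Adj.norm_apply_le (X - Y) (lp.single 2 k x)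
  rw [lp.norm_single (by norm_num)] at h2
  rw [dist_eq_norm] at hXY
  rw [h1]
  refine (norm_add_le _ _).trans ?_
  have h3 : ‖X - Y‖ * ‖x‖ ≤ ε / 2 * ‖x‖ := by gcongr
  linarith [hk x]

/-! ### Homogeneous operators -/

/-- `X` is homogeneous of degree `d` for the gauge action. -/
def IsHomogeneous (d : ℤ) (X : Adj G) : Prop :=
  ∀ t : ℝ, gauge G t X = Complex.exp (Complex.I * d * t) • X

theorem gaugeUnitary_apply (t : ℝ) (ξ : Fock G) (k : ℕ) :
    (gaugeUnitary G t).toCLM ξ k = Complex.exp (Complex.I * k * t) • ξ k := rfl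

theorem gaugeUnitary_mul_star (t : ℝ) : gaugeUnitary G t * star (gaugeUnitary G t) = 1 := by
  have h : gaugeUnitary G t * gaugeUnitary G (-t) = 1 := by
    refine Adj.ext fun ξ => ?_
    ext1; funext k
    rw [Adj.mul_apply, gaugeUnitary_apply, gaugeUnitary_apply, smul_smul, ← Complex.exp_add,
      Adj.one_apply]
    simp
  rw [left_inv_eq_right_inv (star_gaugeUnitary_mul t) h, h]

theorem isHomogeneous_of_mul_eq {d : ℤ} {X : Adj G} (h : ∀ t : ℝ, gaugeUnitary G t * X =
    Complex.exp (Complex.I * d * t) • (X * gaugeUnitary G t)) : IsHomogeneous d X := fun t => by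
  rw [gauge, h, smul_mul_assoc, mul_assoc X, gaugeUnitary_mul_star, mul_one]

theorem IsHomogeneous.gaugeUnitary_mul {d : ℤ} {X : Adj G} (h : IsHomogeneous d X) (t : ℝ) :
    gaugeUnitary G t * X = Complex.exp (Complex.I * d * t) • (X * gaugeUnitary G t) := by
  rw [← smul_mul_assoc, ← h t, gauge, mul_assoc, star_gaugeUnitary_mul, mul_one]

protected theorem IsHomogeneous.mul {d d' : ℤ} {X Y : Adj G} (hX : IsHomogeneous d X)
    (hY : IsHomogeneous d' Y) : IsHomogeneous (d + d') (X * Y) := fun t => by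
  rw [gauge_mul, hX, hY, smul_mul_smul_comm, ← Complex.exp_add]
  congr 2
  push_cast; ring

protected theorem IsHomogeneous.star {d : ℤ} {X : Adj G} (hX : IsHomogeneous d X) :
    IsHomogeneous (-d) (star X) := fun t => by
  rw [gauge_star, hX, star_smul, RCLike.star_def, ← Complex.exp_conj]
  congr 2
  simp

protected theorem IsHomogeneous.add {d : ℤ} {X Y : Adj G} (hX : IsHomogeneous d X)
    (hY : IsHomogeneous d Y) : IsHomogeneous d (X + Y) := fun t => by
  rw [gauge_add, hX, hY, smul_add]

theorem isHomogeneous_one : IsHomogeneous 0 (1 : Adj G) :=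
  isHomogeneous_of_mul_eq fun t => by simp

protected theorem IsHomogeneous.smul {d : ℤ} {X : Adj G} (hX : IsHomogeneous d X) (c : ℂ) :
    IsHomogeneous d (c • X) := fun t => by
  rw [gauge_smul, hX, smul_comm]

theorem isHomogeneous_S (e : E) : IsHomogeneous 1 (S G e) := by
  classical
  refine isHomogeneous_of_mul_eq fun t => Adj.ext fun ξ => ?_
  ext k γ
  rw [Adj.mul_apply, Adj.smul_apply, Adj.mul_apply, gaugeUnitary_apply, lp.coeFn_smul,
    Pi.smul_apply]
  cases k with
  | zero => rw [S_apply_zero, S_apply_zero]; simp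
  | succ k =>
    rw [PiLp.smul_apply, PiLp.smul_apply, S_apply_succ, S_apply_succ]
    split_ifs
    · rw [gaugeUnitary_apply, PiLp.smul_apply, smul_smul, ← Complex.exp_add]
      congr 2
      push_cast; ring
    · simp

/-- The gauge unitaries multiply the component in level `k` by one phase, and homogeneity prescribes
the phase of level `m + d`; if these differ for some `t`, the component vanishes. -/
theorem IsHomogeneous.apply_single_eq_zero {d : ℤ} {X : Adj G} (hX : IsHomogeneous d X) {m k : ℕ}
    (x : Level G m) (h : (k : ℤ) ≠ m + d) : X.toCLM (lp.single 2 m x) k = 0 := by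
  have hr : ((k : ℝ) - (m + d)) ≠ 0 := by
    rw [sub_ne_zero]
    exact_mod_cast h
  -- This `t` makes the two phases differ by the factor exp(πi) = -1, so the component equals its
  -- own negative.
  set t : ℝ := Real.pi / ((k : ℝ) - (m + d)) with ht
  have hW : (gaugeUnitary G t).toCLM (lp.single 2 m x) =
      Complex.exp (Complex.I * m * t) • lp.single 2 m x := by
    ext1; funext j
    rw [gaugeUnitary_apply, lp.coeFn_smul, Pi.smul_apply]
    by_cases hj : j = m
    · rw [hj]
    · rw [lp.single_apply_ne _ _ _ hj, smul_zero, smul_zero]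
  have h1 := congrArg (fun Y : Adj G => Y.toCLM (lp.single 2 m x) k) (hX.gaugeUnitary_mul t)
  simp only [Adj.mul_apply, Adj.smul_apply, gaugeUnitary_apply, hW, map_smul, lp.coeFn_smul,
    Pi.smul_apply, smul_smul, ← Complex.exp_add] at h1
  have h2 : Complex.exp (Complex.I * k * t) =
      -Complex.exp (Complex.I * d * t + Complex.I * m * t) := by
    have h3 : Complex.I * k * t = Complex.I * d * t + Complex.I * m * t + Real.pi * Complex.I := by
      have h4 : ((k : ℝ) - (m + d)) * t = Real.pi := by rw [ht]; field_simp
      have h5 := congrArg (fun r : ℝ => (r : ℂ)) h4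
      push_cast at h5
      linear_combination Complex.I * h5
    rw [h3, Complex.exp_add, Complex.exp_pi_mul_I, mul_neg_one]
  rw [h2, neg_smul, neg_eq_iff_add_eq_zero, ← two_smul ℂ, smul_smul] at h1
  exact (smul_eq_zero.1 h1).resolve_left (mul_ne_zero two_ne_zero (Complex.exp_ne_zero _))

theorem mem_D_iff {Z : WeightSeq G} {X : Adj G} : X ∈ Z.D ↔ X ∈ Z.T ∧ IsHomogeneous 0 X := by
  refine and_congr_right fun _ => forall_congr' fun t => ?_
  simp

theorem mem_F_iff {Z : WeightSeq G} {X : Adj G} : X ∈ Z.F ↔ X ∈ Z.T ∧ IsHomogeneous 1 X := by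
  refine and_congr_right fun _ => forall_congr' fun t => ?_
  simp

theorem S_mem_F (Z : WeightSeq G) (e : E) : S G e ∈ Z.F :=
  mem_F_iff.2 ⟨S_mem_T Z e, isHomogeneous_S e⟩

theorem isHomogeneous_of_mem_F_pow {Z : WeightSeq G} {n : ℕ} {X : Adj G} (hX : X ∈ Z.F ^ n) :
    IsHomogeneous n X := by
  induction n generalizing X with
  | zero =>
    rw [pow_zero, Submodule.mem_one] at hX
    obtain ⟨c, rfl⟩ := hX
    rw [Algebra.algebraMap_eq_smul_one]
    exact isHomogeneous_one.smul c
  | succ n ih =>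
    rw [pow_succ] at hX
    refine Submodule.mul_induction_on hX (fun A hA B hB => ?_) fun A B => IsHomogeneous.add
    exact_mod_cast (ih hA).mul (mem_F_iff.1 hB).2

/-- The exponent is positive because `Z.F ^ 0` consists of scalars, while `Z.T` is only given as a
non-unital algebra. -/
theorem mem_T_of_mem_F_pow {Z : WeightSeq G} {n : ℕ} {X : Adj G} (hX : X ∈ Z.F ^ (n + 1)) :
    X ∈ Z.T := by
  induction n generalizing X with
  | zero =>
    rw [zero_add, pow_one] at hX
    exact hX.1
  | succ n ih =>
    rw [pow_succ] at hX
    exact Submodule.mul_induction_on hX (fun A hA B hB => mul_mem (ih hA) hB.1)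
      fun A B => add_mem

theorem star_mul_mem_D {Z : WeightSeq G} {n : ℕ} {X Y : Adj G} (hX : X ∈ Z.F ^ (n + 1))
    (hY : Y ∈ Z.F ^ (n + 1)) : star X * Y ∈ Z.D := by
  refine mem_D_iff.2 ⟨mul_mem (star_mem (mem_T_of_mem_F_pow hX)) (mem_T_of_mem_F_pow hY), ?_⟩
  simpa using (isHomogeneous_of_mem_F_pow hX).star.mul (isHomogeneous_of_mem_F_pow hY)

/-- The last factor absorbs `A`, since multiplying an element of F by one of 𝒟 keeps degree one. -/
theorem mul_mem_F_pow {Z : WeightSeq G} {n : ℕ} {X A : Adj G} (hX : X ∈ Z.F ^ (n + 1))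
    (hA : A ∈ Z.D) : X * A ∈ Z.F ^ (n + 1) := by
  rw [pow_succ] at hX ⊢
  refine Submodule.mul_induction_on hX (fun B hB C hC => ?_) fun B C hB hC => ?_
  · rw [mul_assoc]
    refine Submodule.mul_mem_mul hB (mem_F_iff.2 ⟨mul_mem hC.1 hA.1, ?_⟩)
    simpa using (mem_F_iff.1 hC).2.mul (mem_D_iff.1 hA).2
  · rw [add_mul]
    exact add_mem hB hC

theorem SPath_mem_F_pow (Z : WeightSeq G) {n : ℕ} (α : G.Path n) : SPath G α ∈ Z.F ^ n := by
  induction n with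
  | zero =>
    rw [SPath, List.ofFn_zero, List.prod_nil, pow_zero]
    exact Submodule.one_le.1 le_rfl
  | succ n ih =>
    rw [← α.cons_eq α.s_edge_zero, ← S_mul_SPath, pow_succ']
    exact Submodule.mul_mem_mul (S_mem_F Z _) (ih _)

theorem shiftSum_pow_mem (Z : WeightSeq G) (n : ℕ) : shiftSum G ^ n ∈ Z.F ^ n :=
  Submodule.pow_mem_pow _ (sum_mem fun e _ => S_mem_F Z e) n

theorem rangeSum_mem_D (Z : WeightSeq G) : rangeSum G ∈ Z.D := by
  refine sum_mem fun e _ => mem_D_iff.2 ⟨mul_mem (S_mem_T Z e) (star_mem (S_mem_T Z e)), ?_⟩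
  simpa using (isHomogeneous_S e).mul (isHomogeneous_S e).star

/-! ### Homogeneous operators when every vertex emits at most one edge -/

/-- The adjoint of `X` sends δ_β to a vector in the same level, by homogeneity, and supported on
paths with source `β.src`, by commutation with the right action. The only such path is `β`, so `X`
is diagonal in the path basis. -/
theorem IsHomogeneous.exists_apply_eq_mul (hs : Function.Injective G.s) {X : Adj G}
    (hX : IsHomogeneous 0 X) {k : ℕ} (β : G.Path k) :
    ∃ c : ℂ, ∀ ξ, X.toCLM ξ k β = c * ξ k β := by
  classical
  set η := (star X).toCLM (pathVec β) with hη
  have hstar : IsHomogeneous 0 (star X) := by simpa using hX.star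
  have hR : fockRight G (Pi.single β.src 1) (pathVec β) = pathVec β := by
    ext m γ
    rw [fockRight_apply]
    by_cases hm : m = k
    · subst hm
      rw [pathVec_apply]
      split_ifs with h
      · rw [h, Pi.single_eq_same, one_mul]
      · rw [mul_zero]
    · rw [pathVec_apply_ne _ hm]; simp
  have hηR : η = fockRight G (Pi.single β.src 1) η := by
    have h := (isAdjointable_fock_iff G (star X).toCLM).1 (star X).2 β.src (pathVec β)
    rwa [hR] at h
  have hηβ : η = η k β • pathVec β := by
    ext m γ
    rw [lp.coeFn_smul, Pi.smul_apply, PiLp.smul_apply]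
    by_cases hm : m = k
    · subst hm
      rw [pathVec_apply]
      split_ifs with h
      · rw [h, smul_eq_mul, mul_one]
      · rw [hηR, fockRight_apply, Pi.single_eq_of_ne, zero_mul, smul_zero]
        exact fun h' => h (DGraph.Path.eq_of_src_eq hs h')
    · rw [pathVec_apply_ne _ hm, hη, pathVec, hstar.apply_single_eq_zero _ (by simpa using hm)]
      simp
  refine ⟨conj (η k β), fun ξ => ?_⟩
  rw [← inner_pathVec, ← Adj.inner_star_left, ← hη, hηβ, inner_smul_left, ← hηβ, inner_pathVec]

protected theorem IsHomogeneous.mul_comm (hs : Function.Injective G.s) {X Y : Adj G}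
    (hX : IsHomogeneous 0 X) (hY : IsHomogeneous 0 Y) : X * Y = Y * X := by
  refine Adj.ext fun ξ => ?_
  ext k β
  obtain ⟨c, hc⟩ := hX.exists_apply_eq_mul hs β
  obtain ⟨d, hd⟩ := hY.exists_apply_eq_mul hs β
  rw [Adj.mul_apply, Adj.mul_apply, hc, hd, hd, hc, mul_left_comm]

/-! ### The quotient -/

theorem q_eq_zero_iff {X : Adj G} : q G X = 0 ↔ X ∈ compacts G :=
  Ideal.Quotient.eq_zero_iff_mem

theorem q_rangeSum : q G (rangeSum G) = 1 := by
  have h := q_eq_zero_iff.2 (one_sub_rangeSum_mem_compacts (G := G))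
  rw [map_sub, map_one, sub_eq_zero] at h
  exact h.symm

/-- Provides the unit at which an isomorphism of correspondences is evaluated. -/
theorem one_mem_qD (Z : WeightSeq G) : (1 : Calkin G) ∈ Z.qD :=
  ⟨rangeSum G, rangeSum_mem_D Z, q_rangeSum⟩

theorem u_mem_qFpow (Z : WeightSeq G) {n : ℕ} (α : G.Path n) : u G α ∈ Z.qFpow n :=
  ⟨SPath G α, SPath_mem_F_pow Z α, rfl⟩

theorem qD_mul_comm (hs : Function.Injective G.s) {Z : WeightSeq G} {a b : Calkin G}
    (ha : a ∈ Z.qD) (hb : b ∈ Z.qD) : a * b = b * a := by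
  obtain ⟨A, hA, rfl⟩ := ha
  obtain ⟨B, hB, rfl⟩ := hb
  change q G A * q G B = q G B * q G A
  rw [← map_mul, ← map_mul, (mem_D_iff.1 hA).2.mul_comm hs (mem_D_iff.1 hB).2]

/-- Inserting 1 = ∑ q(S_e) q(S_e)* after q(X) shows that annihilating q(Fⁿ⁺¹) implies annihilating
q(Fⁿ); at exponent zero this gives p · 1 = 0. -/
theorem eq_zero_of_mul_q_F_pow_eq_zero (Z : WeightSeq G) {n : ℕ} {p : Calkin G}
    (h : ∀ X ∈ Z.F ^ n, p * q G X = 0) : p = 0 := by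
  induction n with
  | zero => simpa using h 1 (Submodule.one_le.1 (pow_zero Z.F).ge)
  | succ n ih =>
    refine ih fun X hX => ?_
    rw [← mul_one (q G X), ← q_rangeSum, rangeSum, map_sum, Finset.mul_sum, Finset.mul_sum]
    refine Finset.sum_eq_zero fun e _ => ?_
    rw [map_mul, ← mul_assoc (q G X), ← map_mul, ← mul_assoc, h, zero_mul]
    rw [pow_succ]
    exact Submodule.mul_mem_mul hX (S_mem_F Z e)

/-! ### Isomorphisms of correspondences -/

/-- An isomorphism of correspondences `q(𝒟) → q(Fⁿ)` is multiplication by an isometry of `q(Fⁿ)`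
that commutes with `q(𝒟)`. -/
theorem exists_isometry_of_iso {Z : WeightSeq G} {n : ℕ} {w : Z.qD →ₗ[ℂ] Z.qFpow n}
    (hw : Z.IsCorrespondenceIso n w) : ∃ y ∈ Z.qFpow n, star y * y = 1 ∧
      (∀ a ∈ Z.qD, y * a = a * y) ∧ ∀ z ∈ Z.qFpow n, ∃ a ∈ Z.qD, z = a * y := by
  let o : Z.qD := ⟨1, one_mem_qD Z⟩
  -- Left and right linearity at the unit give w(a) = a w(1) and w(a) = w(1) a; comparing them
  -- yields the commutation.
  have hl : ∀ a : Z.qD, (w a : Calkin G) = a * w o := fun a => by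
    rw [← hw.map_left]
    congr 2
    exact Subtype.ext (mul_one _).symm
  have hr : ∀ a : Z.qD, (w a : Calkin G) = w o * a := fun a => by
    rw [← hw.map_right]
    congr 2
    exact Subtype.ext (one_mul _).symm
  refine ⟨w o, (w o).2, ?_, fun a ha => ?_, fun z hz => ?_⟩
  · rw [hw.map_inner]
    simp [o]
  · exact (hr ⟨a, ha⟩).symm.trans (hl ⟨a, ha⟩)
  · obtain ⟨a, ha⟩ := hw.surjective ⟨z, hz⟩
    exact ⟨a, a.2, by rw [← hl, ha]⟩

/-- Elements of q(Fⁿ) have the form ay = ya, and (1 - yy*)y = 0 because y is an isometry. -/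
theorem mul_star_eq_one_of_generates {Z : WeightSeq G} {n : ℕ} {y : Calkin G}
    (hy : star y * y = 1) (hcomm : ∀ a ∈ Z.qD, y * a = a * y)
    (hgen : ∀ z ∈ Z.qFpow n, ∃ a ∈ Z.qD, z = a * y) : y * star y = 1 := by
  refine (sub_eq_zero.1 (eq_zero_of_mul_q_F_pow_eq_zero Z (n := n) fun X hX => ?_)).symm
  obtain ⟨a, ha, h⟩ := hgen (q G X) ⟨X, hX, rfl⟩
  rw [h, ← hcomm a ha, sub_mul, one_mul, ← mul_assoc, mul_assoc y, hy, mul_one, sub_self]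

/-- If `q(Fⁿ)` contains a coisometry, then eventually there are at least as many paths of length `k`
as of length `k + n`. -/
theorem eventually_card_path_le {Z : WeightSeq G} {n : ℕ} {y : Calkin G} (hy : y ∈ Z.qFpow n)
    (h : y * star y = 1) :
    ∀ᶠ k in Filter.atTop, Fintype.card (G.Path (k + n)) ≤ Fintype.card (G.Path k) := by
  obtain ⟨Y, hY, rfl⟩ := hy
  have hK : 1 - Y * star Y ∈ compacts G := by
    rw [← q_eq_zero_iff, map_sub, map_one, map_mul, map_star, sub_eq_zero]
    exact h.symm
  have hdeg := (isHomogeneous_of_mem_F_pow hY).star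
  have hev := eventually_norm_le_of_mem_compacts hK (ε := 1 / 2) (by norm_num)
  filter_upwards [(Filter.tendsto_add_atTop_nat n).eventually hev] with k hk
  -- The adjoint of `Y` has degree `-n`, so it maps level `k + n` into level `k` and `f` loses
  -- nothing.
  let f : Level G (k + n) →ₗ[ℂ] Level G k :=
    { toFun := fun x => (star Y).toCLM (lp.single 2 (k + n) x) k
      map_add' := fun x x' => by rw [lp.single_add, map_add]; rfl
      map_smul' := fun c x => by rw [lp.single_smul, map_smul]; rfl }
  -- If the adjoint of `Y` kills x, then 1 - YY* fixes x, yet it at least halves the norm on this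
  -- level. Any constant below 1 would serve in place of 1/2.
  have hf : Function.Injective f := by
    refine (injective_iff_map_eq_zero f).2 fun x hx => ?_
    have h0 : (star Y).toCLM (lp.single 2 (k + n) x) = 0 := by
      ext1; funext j
      by_cases hj : j = k
      · subst hj; exact hx
      · exact hdeg.apply_single_eq_zero x (by push_cast; omega)
    have h1 := hk x
    rw [Adj.sub_apply, Adj.mul_apply, h0, map_zero, sub_zero, Adj.one_apply,
      lp.norm_single (by norm_num)] at h1
    exact norm_eq_zero.1 (by linarith [norm_nonneg x])
  simpa using LinearMap.finrank_le_finrank_of_injective hf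

theorem not_exists_iso_of_emits_two (hsink : ∀ v, ¬ G.IsSink v) (Z : WeightSeq G) {n : ℕ}
    (hn : 1 ≤ n) {v : V} {e e' : E} (hne : e ≠ e') (he : G.s e = v) (he' : G.s e' = v)
    (hv : ∀ m, ∃ α : G.Path m, α.rng = v) :
    ¬ ∃ w : Z.qD →ₗ[ℂ] Z.qFpow n, Z.IsCorrespondenceIso n w := by
  rintro ⟨w, hw⟩
  obtain ⟨y, hy, hyy, hcomm, hgen⟩ := exists_isometry_of_iso hw
  obtain ⟨k, hk⟩ :=
    (eventually_card_path_le hy (mul_star_eq_one_of_generates hyy hcomm hgen)).exists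
  have hmono : StrictMono fun m => Fintype.card (G.Path m) := strictMono_nat_of_lt_succ fun m => by
    obtain ⟨α, hα⟩ := hv m
    exact DGraph.card_path_lt_succ hsink hne he he' hα
  exact absurd (hmono (show k < k + n by omega)) hk.not_gt

/-- Here u_α = by, where b lies in the commutative algebra q(𝒟) and y commutes with q(𝒟). -/
theorem u_comm_of_iso (hs : Function.Injective G.s) {Z : WeightSeq G} {n : ℕ}
    {w : Z.qD →ₗ[ℂ] Z.qFpow n} (hw : Z.IsCorrespondenceIso n w) (α : G.Path n) {a : Calkin G}
    (ha : a ∈ Z.qD) : u G α * a = a * u G α := by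
  obtain ⟨y, hy, hyy, hcomm, hgen⟩ := exists_isometry_of_iso hw
  obtain ⟨b, hb, h⟩ := hgen _ (u_mem_qFpow Z α)
  rw [h, mul_assoc, hcomm a ha, ← mul_assoc, qD_mul_comm hs hb ha, mul_assoc]

/-- The isomorphism is multiplication by a power of `q G (shiftSum G)`. This element is unitary
because the source map is bijective, and the hypothesis makes the power commute with q(𝒟), which
gives left linearity. -/
theorem exists_iso_of_u_comm (hs : Function.Bijective G.s) (Z : WeightSeq G) {n : ℕ}
    (h : ∀ α : G.Path (n + 1), ∀ a ∈ Z.qD, u G α * a = a * u G α) :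
    ∃ w : Z.qD →ₗ[ℂ] Z.qFpow (n + 1), Z.IsCorrespondenceIso (n + 1) w := by
  set x : Calkin G := q G (shiftSum G) with hx
  have hx1 : star x * x = 1 := by
    rw [hx, ← map_star, ← map_mul, star_shiftSum_mul_shiftSum hs, map_one]
  have hx2 : x * star x = 1 := by
    rw [hx, ← map_star, ← map_mul, shiftSum_mul_star_shiftSum hs.1, q_rangeSum]
  set y : Calkin G := q G (shiftSum G ^ (n + 1)) with hy
  have hyU : y ∈ unitary (Calkin G) := by
    rw [hy, map_pow]
    exact pow_mem (Unitary.mem_iff.2 ⟨hx1, hx2⟩) _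
  have hcomm : ∀ a ∈ Z.qD, y * a = a * y := by
    intro a ha
    have hmem := shiftSum_pow_mem_span (G := G) n
    rw [hy]
    generalize shiftSum G ^ (n + 1) = X at hmem
    induction hmem using Submodule.span_induction with
    | mem X hX =>
      obtain ⟨α, rfl⟩ := hX
      exact h α a ha
    | zero => simp
    | add X Y _ _ hX hY => rw [map_add, add_mul, mul_add, hX, hY]
    | smul c X _ hX => rw [map_smul, smul_mul_assoc, mul_smul_comm, hX]
  have hF : shiftSum G ^ (n + 1) ∈ Z.F ^ (n + 1) := shiftSum_pow_mem Z (n + 1)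
  have hmap : ∀ a ∈ Z.qD, y * a ∈ Z.qFpow (n + 1) := by
    rintro _ ⟨A, hA, rfl⟩
    exact ⟨shiftSum G ^ (n + 1) * A, mul_mem_F_pow hF hA, map_mul (q G) _ _⟩
  let w : Z.qD →ₗ[ℂ] Z.qFpow (n + 1) :=
    { toFun := fun a => ⟨y * a, hmap a a.2⟩
      map_add' := fun a b => Subtype.ext (mul_add y _ _)
      map_smul' := fun c a => Subtype.ext (mul_smul_comm c y _) }
  have hw : ∀ a : Z.qD, (w a : Calkin G) = y * a := fun a => rfl
  refine ⟨w, ?_, fun a b => ?_, fun a b => ?_, fun a b => ?_⟩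
  · rintro ⟨_, X, hX, rfl⟩
    -- The preimage of q(X) is y* q(X), which comes from an operator of degree zero.
    refine ⟨⟨q G (star (shiftSum G ^ (n + 1)) * X), _, star_mul_mem_D hF hX, rfl⟩, ?_⟩
    refine Subtype.ext ?_
    rw [hw]
    change y * q G (star (shiftSum G ^ (n + 1)) * X) = q G X
    rw [map_mul, map_star, ← hy, ← mul_assoc, Unitary.mul_star_self_of_mem hyU, one_mul]
  · rw [hw, hw]
    change y * (a * b : Calkin G) = _
    rw [← mul_assoc, hcomm a a.2, mul_assoc]
  · rw [hw, hw]
    change y * (a * b : Calkin G) = _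
    rw [mul_assoc]
  · rw [hw, hw, star_mul, mul_assoc, ← mul_assoc (star y), Unitary.star_mul_self_of_mem hyU,
      one_mul]

end WCK

end

/-! ### The proposition -/

theorem mainTheorem10 {V E : Type*} [Fintype V] [Fintype E] (G : WCK.DGraph V E)
    (hsink : ∀ v, ¬ G.IsSink v) (Z : WCK.WeightSeq G) (n : ℕ) (hn : 1 ≤ n) :
    -- no isomorphism if `G` is irreducible, without sources and not a cycle with an entry
    ((Nonempty V ∧ (∀ v, ¬ G.IsSource v) ∧ G.Irreducible ∧ ¬ G.IsCycleWithEntry) →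
      ¬ ∃ w : Z.qD →ₗ[ℂ] Z.qFpow n, Z.IsCorrespondenceIso n w) ∧
    -- sources allowed: no isomorphism if a vertex emitting two edges is the range of paths of
    -- every length
    ((∃ v, (∃ e e' : E, e ≠ e' ∧ G.s e = v ∧ G.s e' = v) ∧ ∀ m, ∃ α : G.Path m, α.rng = v) →
      ¬ ∃ w : Z.qD →ₗ[ℂ] Z.qFpow n, Z.IsCorrespondenceIso n w) ∧
    -- the case of a cycle with an entry
    (∀ k l : ℕ, G.IsC k l →
      ((∀ α : G.Path n, ∀ a ∈ Z.qD, WCK.u G α * a = a * WCK.u G α) ↔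
        ∃ w : Z.qD →ₗ[ℂ] Z.qFpow n, Z.IsCorrespondenceIso n w)) := by
  refine ⟨?_, ?_, fun k l hC => ?_⟩
  · rintro ⟨hne, hsource, hirr, hcyc⟩
    -- Without sinks the source map is onto; were it also injective, the graph would be a cycle. So
    -- two edges share a source, and that vertex is the range of paths of every length, as there are
    -- no sources.
    have hs : ¬ Function.Injective G.s := fun hinj => by
      refine hcyc (hirr.isCycleWithEntry hsource ⟨hinj, fun v => ?_⟩)
      simpa [WCK.DGraph.IsSink] using hsink v
    simp only [Function.Injective, not_forall] at hs
    obtain ⟨e, e', hee, hne'⟩ := hs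
    exact WCK.not_exists_iso_of_emits_two hsink Z hn hne' rfl hee.symm
      (WCK.DGraph.exists_path_of_no_source hsource _)
  · rintro ⟨v, ⟨e, e', hne, he, he'⟩, hv⟩
    exact WCK.not_exists_iso_of_emits_two hsink Z hn hne he he' hv
  · have hs := hC.s_bijective
    obtain ⟨m, rfl⟩ := Nat.exists_eq_succ_of_ne_zero (Nat.one_le_iff_ne_zero.1 hn)
    refine ⟨WCK.exists_iso_of_u_comm hs Z, ?_⟩
    rintro ⟨w, hw⟩ α a ha
    exact WCK.u_comm_of_iso hs.1 hw α ha
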